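/- All matrices are real, and $m,n$ are non-negative integers. For $A\in\mathbb R^{n\times n}$, $B\in\mathbb R^{n\times m}$, $C\in\mathbb R^{m\times n}$, $D\in\mathbb R^{m\times m}$ let $Q(z)=C(zI-A)^{-1}B+D$, an $m\times m$ matrix of real rational functions; $(A,B,C,D)$ is called a realization of $Q(z)$. It is minimal if no realization of the same $Q(z)$ has a smaller state dimension than $n$. The function $Q(z)$ is all-pass if $Q(z)\,Q(z^{-1})^{\top}=I$ identically. The pair $(A,B)$ is reachable if $[B\mid AB\mid\dots\mid A^{n-1}B]$ has rank $n$, and $(A,C)$ is observable if $(A^{\top},C^{\top})$ is reachable. Consider for unknown $n\times n$ matrices $P$ and $Q$ the systems $$\text{(P)}\quad APA^{\top}-P=BB^{\top},\qquad BD^{\top}-APC^{\top}=0,\qquad DD^{\top}-CPC^{\top}=I,$$ $$\text{(Q)}\quad A^{\top}QA-Q=C^{\top}C,\qquad C^{\top}D-A^{\top}QB=0,\qquad D^{\top}D-B^{\top}QB=I.$$ **Theorem.** 1. If $(A,B,C,D)$ is a minimal realization of an all-pass function, then $A$ is non-singular if and only if $D$ is non-singular. 2. If $(A,B,C,D)$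 is a minimal realization of an all-pass function, then there exist invertible matrices $P=P^{\top}$ and $Q=Q^{\top}$ with $PQ=I$ such that $P$ solves (P) and $Q$ solves (Q). 3. If $(A,B,C,D)$ is a minimal realization of an all-pass function, then (P) has at most one solution $P\in\mathbb R^{n\times n}$ and (Q) has at most one solution $Q\in\mathbb R^{n\times n}$ (symmetric or not). 4. Let $A,B,C,D$ be arbitrary (no minimality assumed). If (P) has a solution $P=P^{\top}$, then $Q(z)$ is all-pass. If (Q) has a solution $Q=Q^{\top}$, then $Q(z)$ is all-pass. Moreover, a non-singular $P=P^{\top}$ solves (P) if and only if $P^{-1}$ solves (Q). 5. Let $(A,B)$ be reachable, with $A\in\mathbb R^{n\times n}$, $B\in\mathbb R^{n\times m}$. A matrix $P=P^{\top}$ satisfies $APA^{\top}-P=BB^{\top}$ if and only if there exist $C\in\mathbb R^{m\times n}$ and $D\in\mathbb R^{m\times m}$ such that $(A,B,C,D)$ is a minimal realization of an all-pass function and $P$ solves (P) for $(A,B,C,D)$. In this case $P$ is non-singular and $I+B^{\top}P^{-1}B$ is positive semidefinite. 6. Let $(A,C)$ be observable, with $A\in\mathbb R^{n\times n}$, $C\in\mathbb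 R^{m\times n}$. A matrix $Q=Q^{\top}$ satisfies $A^{\top}QA-Q=C^{\top}C$ if and only if there exist $B\in\mathbb R^{n\times m}$ and $D\in\mathbb R^{m\times m}$ such that $(A,B,C,D)$ is a minimal realization of an all-pass function and $Q$ solves (Q) for $(A,B,C,D)$. In this case $Q$ is non-singular and $I+CQ^{-1}C^{\top}$ is positive semidefinite. 7. Let $A\in\mathbb R^{n\times n}$, $B\in\mathbb R^{n\times m}$, $C\in\mathbb R^{m\times n}$. If there exist $P=P^{\top}$ and $Q=Q^{\top}$ with $APA^{\top}-P=BB^{\top}$, $A^{\top}QA-Q=C^{\top}C$ and $PQ=I$, then there exists $D\in\mathbb R^{m\times m}$ such that $Q(z)=C(zI-A)^{-1}B+D$ is all-pass. -/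

import Mathlib

open scoped Matrix

noncomputable section

namespace AllPass

theorem nonZeroDivisors_le_comap_aeval_inv :
    nonZeroDivisors (Polynomial ℝ) ≤ (nonZeroDivisors (RatFunc ℝ)).comap
      (Polynomial.aeval (RatFunc.X⁻¹ : RatFunc ℝ) : Polynomial ℝ →ₐ[ℝ] RatFunc ℝ) := by
  intro p hp
  have hp0 : p ≠ 0 := nonZeroDivisors.ne_zero hp
  refine mem_nonZeroDivisors_of_ne_zero fun h => ?_
  exact RatFunc.transcendental_X (K := ℝ) (IsAlgebraic.inv_iff.mp ⟨p, hp0, h⟩)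

/-- The substitution `z ↦ z⁻¹` on real rational functions in one variable, as a homomorphism of
`ℝ`-algebras. -/
def invSubst : RatFunc ℝ →ₐ[ℝ] RatFunc ℝ :=
  RatFunc.liftAlgHom (Polynomial.aeval (RatFunc.X⁻¹ : RatFunc ℝ)) nonZeroDivisors_le_comap_aeval_inv

theorem invSubst_X : invSubst RatFunc.X = RatFunc.X⁻¹ := by
  rw [invSubst, RatFunc.liftAlgHom_apply]
  simp

/-- `Q^*(z) = Q(z⁻¹)ᵀ` for a square rational matrix function `Q(z)`. -/
def paraConj {m : ℕ} (Q : Matrix (Fin m) (Fin m) (RatFunc ℝ)) :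
    Matrix (Fin m) (Fin m) (RatFunc ℝ) :=
  (Q.map invSubst)ᵀ

/-- A square rational matrix function `Q(z)` is (discrete-time) all-pass if `Q(z) Q(z⁻¹)ᵀ = I`. -/
def IsAllPass {m : ℕ} (Q : Matrix (Fin m) (Fin m) (RatFunc ℝ)) : Prop :=
  Q * paraConj Q = 1

/-- A real matrix, regarded as a constant rational matrix function. -/
def const {k l : ℕ} (M : Matrix (Fin k) (Fin l) ℝ) : Matrix (Fin k) (Fin l) (RatFunc ℝ) :=
  M.map RatFunc.C

/-- The transfer function `C (zI - A)⁻¹ B + D`, a matrix of rational functions of `z`. The matrix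
`zI - A` is always invertible over the field of rational functions, since its determinant is the
characteristic polynomial of `A`. -/
def transferFunction {n m : ℕ} (A : Matrix (Fin n) (Fin n) ℝ) (B : Matrix (Fin n) (Fin m) ℝ)
    (C : Matrix (Fin m) (Fin n) ℝ) (D : Matrix (Fin m) (Fin m) ℝ) :
    Matrix (Fin m) (Fin m) (RatFunc ℝ) :=
  const C * (Matrix.scalar (Fin n) (RatFunc.X : RatFunc ℝ) - const A)⁻¹ * const B + const D

/-- `(A, B, C, D)` is a minimal realization (of its transfer function): no realization of the same
transfer function has a smaller state dimension. -/
def IsMinimal {n m : ℕ} (A : Matrix (Fin n) (Fin n) ℝ) (B : Matrix (Fin n) (Fin m) ℝ)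
    (C : Matrix (Fin m) (Fin n) ℝ) (D : Matrix (Fin m) (Fin m) ℝ) : Prop :=
  ∀ (n' : ℕ) (A' : Matrix (Fin n') (Fin n') ℝ) (B' : Matrix (Fin n') (Fin m) ℝ)
    (C' : Matrix (Fin m) (Fin n') ℝ) (D' : Matrix (Fin m) (Fin m) ℝ),
    transferFunction A' B' C' D' = transferFunction A B C D → n ≤ n'

/-- `(A, B, C, D)` is a minimal realization of an all-pass function. -/
def IsMinimalAllPass {n m : ℕ} (A : Matrix (Fin n) (Fin n) ℝ) (B : Matrix (Fin n) (Fin m) ℝ)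
    (C : Matrix (Fin m) (Fin n) ℝ) (D : Matrix (Fin m) (Fin m) ℝ) : Prop :=
  IsMinimal A B C D ∧ IsAllPass (transferFunction A B C D)

/-- `(A, B)` is reachable: the matrix `[B | A B | ⋯ | A ^ (n - 1) B]` has rank `n`. -/
def IsReachable {n m : ℕ} (A : Matrix (Fin n) (Fin n) ℝ) (B : Matrix (Fin n) (Fin m) ℝ) : Prop :=
  (Matrix.of fun (i : Fin n) (p : Fin n × Fin m) => (A ^ (p.1 : ℕ) * B) i p.2).rank = n

/-- `(A, C)` is observable: the stacked matrix with blocks `C, C A, …, C A ^ (n - 1)` has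
rank `n`. -/
def IsObservable {n m : ℕ} (A : Matrix (Fin n) (Fin n) ℝ) (C : Matrix (Fin m) (Fin n) ℝ) : Prop :=
  (Matrix.of fun (p : Fin n × Fin m) (j : Fin n) => (C * A ^ (p.1 : ℕ)) p.2 j).rank = n

/-- The equations `A P Aᵀ - P = B Bᵀ`, `B Dᵀ - A P Cᵀ = 0`, `D Dᵀ - C P Cᵀ = I`. -/
def SolvesP {n m : ℕ} (A : Matrix (Fin n) (Fin n) ℝ) (B : Matrix (Fin n) (Fin m) ℝ)
    (C : Matrix (Fin m) (Fin n) ℝ) (D : Matrix (Fin m) (Fin m) ℝ)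
    (P : Matrix (Fin n) (Fin n) ℝ) : Prop :=
  A * P * Aᵀ - P = B * Bᵀ ∧ B * Dᵀ - A * P * Cᵀ = 0 ∧ D * Dᵀ - C * P * Cᵀ = 1

/-- The equations `Aᵀ Q A - Q = Cᵀ C`, `Cᵀ D - Aᵀ Q B = 0`, `Dᵀ D - Bᵀ Q B = I`. -/
def SolvesQ {n m : ℕ} (A : Matrix (Fin n) (Fin n) ℝ) (B : Matrix (Fin n) (Fin m) ℝ)
    (C : Matrix (Fin m) (Fin n) ℝ) (D : Matrix (Fin m) (Fin m) ℝ)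
    (Q : Matrix (Fin n) (Fin n) ℝ) : Prop :=
  Aᵀ * Q * A - Q = Cᵀ * C ∧ Cᵀ * D - Aᵀ * Q * B = 0 ∧ Dᵀ * D - Bᵀ * Q * B = 1

end AllPass

end

/-!
All-pass functions correspond to matrices `M = [A B; C D]` that are orthogonal for the indefinite
form `J = diag(P, -I)`: the equations `SolvesP`, called (P) below, say `M J Mᵀ = J`. Taking
inverses gives `Mᵀ J⁻¹ M = J⁻¹`, which are the equations `SolvesQ`, called (Q), for `P⁻¹`
(`SolvesP.solvesQ_inv`). Statements about (Q) and about observability follow from those about (P)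
and reachability by transposing the realization.

*From (P) to all-pass.* The equation `A P Aᵀ - P = B Bᵀ` splits the product of two resolvents in
`Q(z) Q(z⁻¹)ᵀ` into terms with one resolvent each, and the other two equations make these cancel
(`SolvesP.isAllPass`).

*From all-pass to (P).* Let `q₀ = D`, `qⱼ₊₁ = C Aʲ B` be the Markov parameters and `Uⱼ(z)` the
polynomial part of `zʲ Q(z)`, so that `zʲ Q(z) = C Aʲ (zI - A)⁻¹ B + Uⱼ(z)`. Multiplying by
`Q(z⁻¹)ᵀ` and taking the coefficient of `zᵏ` in the Laurent expansion at `z = 0` gives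
`δⱼₖ I = C Aʲ Fₖ + Gⱼₖ`, where `Fₖ` are the coefficients of `(zI - A)⁻¹ B Q(z⁻¹)ᵀ` and
`Gⱼₖ = ∑ qⱼ₋ₗ qₖ₋ₗᵀ`, summed over `l ≤ min j k`, satisfies `Gⱼₖᵀ = Gₖⱼ`. Hence `C Aʲ Fₖ` is the
transpose of `C Aᵏ Fⱼ`, and observability yields a symmetric `P` with `Fₖ = -P (Aᵀ)ᵏ Cᵀ`
(`exists_isSymm_stateCoeff_eq`). Comparing coefficients in `z F = A F + B Q(z⁻¹)ᵀ` gives (P)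
(`exists_isSymm_solvesP`). Working with Laurent coefficients covers singular `A` and `D`, where
`Q(z)⁻¹` has a pole at infinity and hence no realization of the form `C (zI - A)⁻¹ B + D`.

*Inertia.* If `A P Aᵀ - P = B Bᵀ` with `P` symmetric, then `x ↦ (Aᵀ x, Bᵀ x)` is an isometry from
the form `P` to the form `J`, and both have the same positive index. So a vector that is
`J`-orthogonal to the range of this isometry, and on which `J` is nonnegative, lies in the radical
of `J` (`kreinForm_orthogonal_radical`). This gives the nonsingularity of `P` when `(A, B)` is
reachable (`isUnit_of_isReachable`), and for nonsingular `P` it shows that the `J`-orthogonal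
complement of the range is negative definite of dimension `m`; an orthonormal basis of it supplies
the rows of `[C D]` (`exists_solvesP`).

*Uniqueness.* The difference `Δ` of two solutions of (P) satisfies `A Δ Aᵀ = Δ` and `A Δ Cᵀ = 0`.
The columns of `Δ` lie in the range of every power of `A`, and `A` is injective on the intersection
of these ranges, so `Δ (Aᵀ)ᵏ Cᵀ = 0` for all `k` (`SolvesP.eq_of_isObservable`).

*Minimality* is equivalent to reachability together with observability, by restriction to the
reachable subspace (`IsMinimal.isReachable`) and by the rank of the Hankel matrix of Markov
parameters (`isMinimal_of_isReachable_of_isObservable`).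
-/

open scoped Matrix

noncomputable section

namespace AllPass

/-! ### Rational matrix functions -/

section Rational

variable {n m k l : ℕ}

theorem const_mul (M : Matrix (Fin k) (Fin l) ℝ) (N : Matrix (Fin l) (Fin m) ℝ) :
    const (M * N) = const M * const N :=
  Matrix.map_mul

theorem const_add (M N : Matrix (Fin k) (Fin l) ℝ) : const (M + N) = const M + const N :=
  Matrix.map_add _ (map_add _) _ _

theorem const_sub (M N : Matrix (Fin k) (Fin l) ℝ) : const (M - N) = const M - const N :=
  Matrix.map_sub _ (map_sub _) _ _

theorem const_one : const (1 : Matrix (Fin k) (Fin k) ℝ) = 1 :=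
  Matrix.map_one _ (map_zero _) (map_one _)

theorem const_transpose (M : Matrix (Fin k) (Fin l) ℝ) : const Mᵀ = (const M)ᵀ := rfl

theorem invSubst_C (a : ℝ) : invSubst (RatFunc.C a) = RatFunc.C a := by
  have := invSubst.commutes a
  simpa [RatFunc.algebraMap_eq_C] using this

theorem map_invSubst_const (M : Matrix (Fin k) (Fin l) ℝ) : (const M).map invSubst = const M := by
  ext i j
  simp [const, invSubst_C]

/-- `zI - A` is invertible over `ℝ(z)`: its determinant is the characteristic polynomial. -/
theorem isUnit_scalar_X_sub_const (A : Matrix (Fin n) (Fin n) ℝ) :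
    IsUnit (Matrix.scalar (Fin n) (RatFunc.X : RatFunc ℝ) - const A).det := by
  have h : Matrix.scalar (Fin n) (RatFunc.X : RatFunc ℝ) - const A
      = A.charmatrix.map (algebraMap (Polynomial ℝ) (RatFunc ℝ)) := by
    ext i j
    by_cases hij : i = j
    · subst hij
      simp [const, Matrix.charmatrix_apply_eq]
    · simp [const, Matrix.charmatrix_apply_ne, hij]
  rw [h, ← RingHom.mapMatrix_apply, ← RingHom.map_det, isUnit_iff_ne_zero]
  intro h0
  have := (map_eq_zero_iff _ (RatFunc.algebraMap_injective ℝ)).1 h0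
  exact A.charpoly_monic.ne_zero this

/-- The resolvent `(zI - A)⁻¹` over `ℝ(z)`. -/
def resolvent (A : Matrix (Fin n) (Fin n) ℝ) : Matrix (Fin n) (Fin n) (RatFunc ℝ) :=
  (Matrix.scalar (Fin n) (RatFunc.X : RatFunc ℝ) - const A)⁻¹

theorem transferFunction_eq (A : Matrix (Fin n) (Fin n) ℝ) (B : Matrix (Fin n) (Fin m) ℝ)
    (C : Matrix (Fin m) (Fin n) ℝ) (D : Matrix (Fin m) (Fin m) ℝ) :
    transferFunction A B C D = const C * resolvent A * const B + const D := rfl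

theorem sub_mul_resolvent (A : Matrix (Fin n) (Fin n) ℝ) :
    (Matrix.scalar (Fin n) (RatFunc.X : RatFunc ℝ) - const A) * resolvent A = 1 :=
  Matrix.mul_nonsing_inv _ (isUnit_scalar_X_sub_const A)

theorem resolvent_mul_sub (A : Matrix (Fin n) (Fin n) ℝ) :
    resolvent A * (Matrix.scalar (Fin n) (RatFunc.X : RatFunc ℝ) - const A) = 1 :=
  Matrix.nonsing_inv_mul _ (isUnit_scalar_X_sub_const A)

theorem X_smul_resolvent (A : Matrix (Fin n) (Fin n) ℝ) :
    (RatFunc.X : RatFunc ℝ) • resolvent A = 1 + const A * resolvent A := by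
  have h := sub_mul_resolvent A
  rw [sub_mul, sub_eq_iff_eq_add] at h
  rw [← h, Matrix.scalar_apply, ← Matrix.smul_one_eq_diagonal, smul_mul_assoc, one_mul]

theorem X_smul_resolvent' (A : Matrix (Fin n) (Fin n) ℝ) :
    (RatFunc.X : RatFunc ℝ) • resolvent A = 1 + resolvent A * const A := by
  have h := resolvent_mul_sub A
  rw [mul_sub, sub_eq_iff_eq_add] at h
  rw [← h, Matrix.scalar_apply, ← Matrix.smul_one_eq_diagonal, mul_smul_comm, mul_one]

theorem resolvent_transpose (A : Matrix (Fin n) (Fin n) ℝ) :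
    resolvent Aᵀ = (resolvent A)ᵀ := by
  rw [resolvent, resolvent, Matrix.transpose_nonsing_inv, Matrix.transpose_sub, const_transpose]
  simp

theorem transferFunction_transpose (A : Matrix (Fin n) (Fin n) ℝ) (B : Matrix (Fin n) (Fin m) ℝ)
    (C : Matrix (Fin m) (Fin n) ℝ) (D : Matrix (Fin m) (Fin m) ℝ) :
    transferFunction Aᵀ Cᵀ Bᵀ Dᵀ = (transferFunction A B C D)ᵀ := by
  simp only [transferFunction_eq, resolvent_transpose, const_transpose, Matrix.transpose_add,
    Matrix.transpose_mul, Matrix.mul_assoc]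

theorem IsAllPass.transpose {Q : Matrix (Fin m) (Fin m) (RatFunc ℝ)} (h : IsAllPass Q) :
    IsAllPass Qᵀ := by
  have h1 : paraConj Q * Q = 1 := mul_eq_one_comm.1 h
  have h2 := congrArg Matrix.transpose h1
  rw [Matrix.transpose_mul, Matrix.transpose_one] at h2
  exact h2

theorem IsMinimal.transpose {A : Matrix (Fin n) (Fin n) ℝ} {B : Matrix (Fin n) (Fin m) ℝ}
    {C : Matrix (Fin m) (Fin n) ℝ} {D : Matrix (Fin m) (Fin m) ℝ} (h : IsMinimal A B C D) :
    IsMinimal Aᵀ Cᵀ Bᵀ Dᵀ := by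
  intro n' A' B' C' D' h'
  refine h n' A'ᵀ C'ᵀ B'ᵀ D'ᵀ ?_
  rw [transferFunction_transpose, h', transferFunction_transpose, Matrix.transpose_transpose]

theorem IsMinimalAllPass.transpose {A : Matrix (Fin n) (Fin n) ℝ} {B : Matrix (Fin n) (Fin m) ℝ}
    {C : Matrix (Fin m) (Fin n) ℝ} {D : Matrix (Fin m) (Fin m) ℝ}
    (h : IsMinimalAllPass A B C D) : IsMinimalAllPass Aᵀ Cᵀ Bᵀ Dᵀ :=
  ⟨h.1.transpose, by rw [transferFunction_transpose]; exact h.2.transpose⟩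

theorem map_invSubst_X_smul (M : Matrix (Fin k) (Fin l) (RatFunc ℝ)) :
    ((RatFunc.X : RatFunc ℝ) • M).map invSubst
      = (RatFunc.X : RatFunc ℝ)⁻¹ • M.map invSubst := by
  ext i j
  simp [invSubst_X]

/-- The recursion `R(z⁻¹) = z I + z A R(z⁻¹)` for the resolvent `R` of `A`, which determines the
expansion of `R(z⁻¹)` at `z = 0`. -/
theorem invSubst_resolvent (A : Matrix (Fin n) (Fin n) ℝ) :
    (resolvent A).map invSubst = (RatFunc.X : RatFunc ℝ) • 1
      + (RatFunc.X : RatFunc ℝ) • (const A * (resolvent A).map invSubst) := by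
  have h : ((RatFunc.X : RatFunc ℝ) • resolvent A).map invSubst = _ :=
    congrArg (fun M => M.map invSubst) (X_smul_resolvent A)
  have h2 : (1 + const A * resolvent A).map invSubst
      = 1 + const A * (resolvent A).map invSubst := by
    rw [Matrix.map_add _ (map_add _), Matrix.map_mul, map_invSubst_const,
      Matrix.map_one _ (map_zero _) (map_one _)]
  rw [map_invSubst_X_smul, h2] at h
  rw [← smul_add, ← h, smul_smul, mul_inv_cancel₀ RatFunc.X_ne_zero, one_smul]

end Rational

/-! ### Laurent coefficients and Markov parameters -/

section Coefficients

open scoped RatFunc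

variable {n m k l : ℕ}

/-- The coefficient of `z ^ d` in the Laurent expansion at `z = 0` of a rational function. -/
def laurentCoeff (d : ℤ) : RatFunc ℝ →+ ℝ where
  toFun f := (algebraMap (RatFunc ℝ) (LaurentSeries ℝ) f).coeff d
  map_zero' := by simp
  map_add' f g := by simp

theorem laurentCoeff_C_mul (d : ℤ) (a : ℝ) (f : RatFunc ℝ) :
    laurentCoeff d (RatFunc.C a * f) = a * laurentCoeff d f := by
  have : algebraMap (RatFunc ℝ) (LaurentSeries ℝ) (RatFunc.C a) = HahnSeries.C a := by
    rw [← RatFunc.algebraMap_C, ← IsScalarTower.algebraMap_apply]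
    simp
  simp only [laurentCoeff, AddMonoidHom.coe_mk, ZeroHom.coe_mk, map_mul, this]
  simp

theorem laurentCoeff_X_mul (d : ℤ) (f : RatFunc ℝ) :
    laurentCoeff d (RatFunc.X * f) = laurentCoeff (d - 1) f := by
  simp only [laurentCoeff, AddMonoidHom.coe_mk, ZeroHom.coe_mk, map_mul, RatFunc.coe_X]
  have := HahnSeries.coeff_single_mul_add (r := (1 : ℝ)) (a := d - 1) (b := (1 : ℤ))
    (x := algebraMap (RatFunc ℝ) (LaurentSeries ℝ) f)
  simpa using this

theorem laurentCoeff_X_pow_mul (j : ℕ) (d : ℤ) (f : RatFunc ℝ) :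
    laurentCoeff d (RatFunc.X ^ j * f) = laurentCoeff (d - j) f := by
  induction j generalizing d with
  | zero => simp
  | succ j ih =>
    rw [pow_succ', mul_assoc, laurentCoeff_X_mul, ih, Nat.cast_succ, sub_sub, add_comm (1 : ℤ)]

theorem laurentCoeff_one (d : ℤ) : laurentCoeff d 1 = if d = 0 then 1 else 0 := by
  simp [laurentCoeff, HahnSeries.coeff_one]

theorem exists_laurentCoeff_eq_zero (f : RatFunc ℝ) :
    ∃ N : ℤ, ∀ d < N, laurentCoeff d f = 0 :=
  ⟨(algebraMap (RatFunc ℝ) (LaurentSeries ℝ) f).order,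
    fun _ h => HahnSeries.coeff_eq_zero_of_lt_order h⟩

/-- The matrix of Laurent coefficients of `z ^ d` of a rational matrix function. -/
def coeffMatrix (d : ℤ) (M : Matrix (Fin k) (Fin l) (RatFunc ℝ)) : Matrix (Fin k) (Fin l) ℝ :=
  M.map (laurentCoeff d)

theorem coeffMatrix_add (d : ℤ) (M N : Matrix (Fin k) (Fin l) (RatFunc ℝ)) :
    coeffMatrix d (M + N) = coeffMatrix d M + coeffMatrix d N :=
  Matrix.map_add _ (map_add _) _ _

theorem coeffMatrix_const_mul (d : ℤ) (R : Matrix (Fin k) (Fin l) ℝ)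
    (M : Matrix (Fin l) (Fin m) (RatFunc ℝ)) :
    coeffMatrix d (const R * M) = R * coeffMatrix d M := by
  ext a b
  simp [coeffMatrix, const, Matrix.mul_apply, laurentCoeff_C_mul]

theorem coeffMatrix_mul_const (d : ℤ) (M : Matrix (Fin k) (Fin l) (RatFunc ℝ))
    (R : Matrix (Fin l) (Fin m) ℝ) :
    coeffMatrix d (M * const R) = coeffMatrix d M * R := by
  ext a b
  simp only [coeffMatrix, const, Matrix.mul_apply, Matrix.map_apply, map_sum]
  exact Finset.sum_congr rfl fun c _ => by rw [mul_comm, laurentCoeff_C_mul, mul_comm]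

theorem coeffMatrix_X_pow_smul (d : ℤ) (j : ℕ) (M : Matrix (Fin k) (Fin l) (RatFunc ℝ)) :
    coeffMatrix d ((RatFunc.X : RatFunc ℝ) ^ j • M) = coeffMatrix (d - j) M := by
  ext a b
  simp [coeffMatrix, laurentCoeff_X_pow_mul]

theorem coeffMatrix_X_smul (d : ℤ) (M : Matrix (Fin k) (Fin l) (RatFunc ℝ)) :
    coeffMatrix d ((RatFunc.X : RatFunc ℝ) • M) = coeffMatrix (d - 1) M := by
  simpa using coeffMatrix_X_pow_smul d 1 M

theorem coeffMatrix_one (d : ℤ) :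
    coeffMatrix d (1 : Matrix (Fin k) (Fin k) (RatFunc ℝ)) = if d = 0 then 1 else 0 := by
  ext a b
  by_cases hab : a = b
  · subst hab
    by_cases hd : d = 0 <;> simp [coeffMatrix, laurentCoeff_one, hd]
  · by_cases hd : d = 0 <;> simp [coeffMatrix, hab, hd]

theorem coeffMatrix_const (d : ℤ) (R : Matrix (Fin k) (Fin l) ℝ) :
    coeffMatrix d (const R) = if d = 0 then R else 0 := by
  have := coeffMatrix_const_mul d R (1 : Matrix (Fin l) (Fin l) (RatFunc ℝ))
  rw [Matrix.mul_one, coeffMatrix_one] at this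
  rw [this]
  split_ifs <;> simp

theorem exists_coeffMatrix_eq_zero (M : Matrix (Fin k) (Fin l) (RatFunc ℝ)) :
    ∃ N : ℤ, ∀ d < N, coeffMatrix d M = 0 := by
  choose N hN using fun p : Fin k × Fin l => exists_laurentCoeff_eq_zero (M p.1 p.2)
  obtain ⟨N', hN'⟩ := (Set.finite_range N).bddBelow
  refine ⟨N', fun d hd => ?_⟩
  ext i j
  exact hN (i, j) d (hd.trans_le (hN' ⟨_, rfl⟩))

theorem coeffMatrix_invSubst_resolvent_succ (A : Matrix (Fin n) (Fin n) ℝ) (d : ℤ) :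
    coeffMatrix (d + 1) ((resolvent A).map invSubst)
      = (if d = 0 then 1 else 0) + A * coeffMatrix d ((resolvent A).map invSubst) := by
  conv_lhs => rw [invSubst_resolvent]
  rw [coeffMatrix_add, coeffMatrix_X_smul, coeffMatrix_X_smul, coeffMatrix_const_mul,
    coeffMatrix_one, add_sub_cancel_right]

/-- The expansion of `(z⁻¹ - A)⁻¹` at `z = 0` has neither a polar part nor a constant term. -/
theorem coeffMatrix_invSubst_resolvent_nonpos (A : Matrix (Fin n) (Fin n) ℝ) {d : ℤ}
    (hd : d ≤ 0) : coeffMatrix d ((resolvent A).map invSubst) = 0 := by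
  obtain ⟨N, hN⟩ := exists_coeffMatrix_eq_zero ((resolvent A).map invSubst)
  -- The coefficients vanish far to the left, and the recursion carries this up to degree `0`.
  have key : ∀ t : ℕ, ∀ d : ℤ, d ≤ 0 → d < N + t →
      coeffMatrix d ((resolvent A).map invSubst) = 0 := by
    intro t
    induction t with
    | zero => exact fun d _ h => hN d (by simpa using h)
    | succ t ih =>
      intro d hd0 hdt
      have h := coeffMatrix_invSubst_resolvent_succ A (d - 1)
      rw [sub_add_cancel, if_neg (by omega),
        ih (d - 1) (by omega) (by push_cast at hdt; omega)] at h
      simpa using h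
  exact key (d - N + 1).toNat d hd (by omega)

theorem coeffMatrix_invSubst_resolvent (A : Matrix (Fin n) (Fin n) ℝ) (j : ℕ) :
    coeffMatrix ((j : ℤ) + 1) ((resolvent A).map invSubst) = A ^ j := by
  induction j with
  | zero =>
    rw [coeffMatrix_invSubst_resolvent_succ,
      coeffMatrix_invSubst_resolvent_nonpos A (by simp)]
    simp
  | succ j ih =>
    rw [coeffMatrix_invSubst_resolvent_succ, if_neg (by omega), zero_add, Nat.cast_succ, ih,
      pow_succ']

/-- The Markov parameters `D, C B, C A B, C A² B, …`: the coefficients of the expansion of the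
transfer function in powers of `z⁻¹`. -/
def markov (A : Matrix (Fin n) (Fin n) ℝ) (B : Matrix (Fin n) (Fin m) ℝ)
    (C : Matrix (Fin m) (Fin n) ℝ) (D : Matrix (Fin m) (Fin m) ℝ) :
    ℕ → Matrix (Fin m) (Fin m) ℝ
  | 0 => D
  | j + 1 => C * A ^ j * B

theorem map_invSubst_transferFunction (A : Matrix (Fin n) (Fin n) ℝ) (B : Matrix (Fin n) (Fin m) ℝ)
    (C : Matrix (Fin m) (Fin n) ℝ) (D : Matrix (Fin m) (Fin m) ℝ) :
    (transferFunction A B C D).map invSubst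
      = const C * (resolvent A).map invSubst * const B + const D := by
  rw [transferFunction_eq, Matrix.map_add _ (map_add _), Matrix.map_mul, Matrix.map_mul,
    map_invSubst_const, map_invSubst_const, map_invSubst_const]

theorem coeffMatrix_invSubst_transferFunction (A : Matrix (Fin n) (Fin n) ℝ)
    (B : Matrix (Fin n) (Fin m) ℝ) (C : Matrix (Fin m) (Fin n) ℝ) (D : Matrix (Fin m) (Fin m) ℝ)
    (j : ℕ) :
    coeffMatrix j ((transferFunction A B C D).map invSubst) = markov A B C D j := by
  rw [map_invSubst_transferFunction, coeffMatrix_add, coeffMatrix_mul_const,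
    coeffMatrix_const_mul, coeffMatrix_const]
  cases j with
  | zero => simp [coeffMatrix_invSubst_resolvent_nonpos, markov]
  | succ j =>
    rw [Nat.cast_succ, coeffMatrix_invSubst_resolvent, if_neg (by omega), add_zero, markov]

theorem coeffMatrix_invSubst_transferFunction_neg (A : Matrix (Fin n) (Fin n) ℝ)
    (B : Matrix (Fin n) (Fin m) ℝ) (C : Matrix (Fin m) (Fin n) ℝ) (D : Matrix (Fin m) (Fin m) ℝ)
    {d : ℤ} (hd : d < 0) :
    coeffMatrix d ((transferFunction A B C D).map invSubst) = 0 := by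
  rw [map_invSubst_transferFunction, coeffMatrix_add, coeffMatrix_mul_const,
    coeffMatrix_const_mul, coeffMatrix_const, coeffMatrix_invSubst_resolvent_nonpos A hd.le,
    if_neg hd.ne]
  simp

theorem markov_eq_of_transferFunction_eq {n' : ℕ} {A : Matrix (Fin n) (Fin n) ℝ}
    {B : Matrix (Fin n) (Fin m) ℝ} {C : Matrix (Fin m) (Fin n) ℝ} {D : Matrix (Fin m) (Fin m) ℝ}
    {A' : Matrix (Fin n') (Fin n') ℝ} {B' : Matrix (Fin n') (Fin m) ℝ}
    {C' : Matrix (Fin m) (Fin n') ℝ} {D' : Matrix (Fin m) (Fin m) ℝ}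
    (h : transferFunction A' B' C' D' = transferFunction A B C D) :
    markov A' B' C' D' = markov A B C D := by
  funext j
  rw [← coeffMatrix_invSubst_transferFunction, h, coeffMatrix_invSubst_transferFunction]

end Coefficients

/-! ### Reachability, observability and minimality -/

section Minimality

variable {n m : ℕ}

/-- By the Cayley–Hamilton theorem, a vector annihilating `B, A B, …, A ^ (n - 1) B` annihilates
every `A ^ k B`, so the bound on the exponents can be dropped. -/
theorem isReachable_iff {A : Matrix (Fin n) (Fin n) ℝ} {B : Matrix (Fin n) (Fin m) ℝ} :
    IsReachable A B ↔ ∀ x : Fin n → ℝ, (∀ k : ℕ, x ᵥ* (A ^ k * B) = 0) → x = 0 := by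
  have h1 : IsReachable A B ↔ Function.Injective
      (Matrix.of fun (i : Fin n) (p : Fin n × Fin m) => (A ^ (p.1 : ℕ) * B) i p.2).vecMul := by
    rw [Matrix.vecMul_injective_iff, linearIndependent_iff_card_eq_finrank_span, IsReachable,
      Matrix.rank_eq_finrank_span_row, Set.finrank, Fintype.card_fin]
    exact eq_comm
  have h2 : ∀ x : Fin n → ℝ,
      x ᵥ* (Matrix.of fun (i : Fin n) (p : Fin n × Fin m) => (A ^ (p.1 : ℕ) * B) i p.2) = 0 ↔
        ∀ k : ℕ, k < n → x ᵥ* (A ^ k * B) = 0 := by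
    intro x
    constructor
    · intro h k hk
      funext j
      exact congrFun h (⟨k, hk⟩, j)
    · intro h
      funext p
      exact congrFun (h p.1 p.1.2) p.2
  have h3 : ∀ x : Fin n → ℝ, (∀ k : ℕ, k < n → x ᵥ* (A ^ k * B) = 0) →
      ∀ k : ℕ, x ᵥ* (A ^ k * B) = 0 := by
    intro x hx k
    rcases Nat.eq_zero_or_pos n with hn | hn
    · subst hn
      rw [Subsingleton.elim x 0, Matrix.zero_vecMul]
    · have : Nonempty (Fin n) := ⟨⟨0, hn⟩⟩
      have hdeg : (Polynomial.X ^ k %ₘ A.charpoly).natDegree < n := by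
        have hne : A.charpoly ≠ 1 := by
          intro h
          have := A.charpoly_natDegree_eq_dim
          rw [h, Polynomial.natDegree_one, Fintype.card_fin] at this
          omega
        have := Polynomial.natDegree_modByMonic_lt (Polynomial.X ^ k) A.charpoly_monic hne
        rwa [A.charpoly_natDegree_eq_dim, Fintype.card_fin] at this
      rw [Matrix.pow_eq_aeval_mod_charpoly, Polynomial.aeval_eq_sum_range, Matrix.sum_mul,
        Matrix.vecMul_sum]
      refine Finset.sum_eq_zero fun i hi => ?_
      rw [Matrix.smul_mul, Matrix.vecMul_smul,
        hx i ((Nat.lt_succ_iff.1 (Finset.mem_range.1 hi)).trans_lt hdeg), smul_zero]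
  rw [h1]
  constructor
  · intro h x hx
    exact h (((h2 x).2 fun k _ => hx k).trans (Matrix.zero_vecMul _).symm)
  · intro h
    rw [← Matrix.coe_vecMulLinear, ← LinearMap.ker_eq_bot, LinearMap.ker_eq_bot']
    intro x hx
    exact h x (h3 x ((h2 x).1 hx))

theorem isObservable_iff_isReachable_transpose {A : Matrix (Fin n) (Fin n) ℝ}
    {C : Matrix (Fin m) (Fin n) ℝ} : IsObservable A C ↔ IsReachable Aᵀ Cᵀ := by
  rw [IsObservable, IsReachable, ← Matrix.rank_transpose]
  have : (Matrix.of fun (p : Fin n × Fin m) (j : Fin n) => (C * A ^ (p.1 : ℕ)) p.2 j)ᵀ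
      = Matrix.of fun (i : Fin n) (p : Fin n × Fin m) => (Aᵀ ^ (p.1 : ℕ) * Cᵀ) i p.2 := by
    ext i p
    have h : (C * A ^ (p.1 : ℕ))ᵀ = Aᵀ ^ (p.1 : ℕ) * Cᵀ := by
      rw [Matrix.transpose_mul, Matrix.transpose_pow]
    exact congrFun (congrFun h i) p.2
  rw [this]

theorem IsReachable.eq_zero_of_forall_mul_eq_zero {l : ℕ} {A : Matrix (Fin n) (Fin n) ℝ}
    {B : Matrix (Fin n) (Fin m) ℝ} (h : IsReachable A B) {M : Matrix (Fin l) (Fin n) ℝ}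
    (hM : ∀ k : ℕ, M * (A ^ k * B) = 0) : M = 0 := by
  ext i j
  refine congrFun (isReachable_iff.1 h (M i) fun k => ?_) j
  rw [← Matrix.mul_apply_eq_vecMul, hM k]
  rfl

theorem IsObservable.eq_zero_of_forall_mul_eq_zero {l : ℕ} {A : Matrix (Fin n) (Fin n) ℝ}
    {C : Matrix (Fin m) (Fin n) ℝ} (h : IsObservable A C) {M : Matrix (Fin n) (Fin l) ℝ}
    (hM : ∀ k : ℕ, C * A ^ k * M = 0) : M = 0 := by
  rw [← Matrix.transpose_eq_zero]
  refine (isObservable_iff_isReachable_transpose.1 h).eq_zero_of_forall_mul_eq_zero fun k => ?_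
  rw [← Matrix.transpose_pow, ← Matrix.transpose_mul, ← Matrix.transpose_mul, hM k,
    Matrix.transpose_zero]

theorem IsReachable.exists_right_inverse {A : Matrix (Fin n) (Fin n) ℝ}
    {B : Matrix (Fin n) (Fin m) ℝ} (h : IsReachable A B) :
    ∃ Y : Fin n → Matrix (Fin m) (Fin n) ℝ, ∑ k : Fin n, A ^ (k : ℕ) * B * Y k = 1 := by
  set R := Matrix.of fun (i : Fin n) (p : Fin n × Fin m) => (A ^ (p.1 : ℕ) * B) i p.2 with hR
  have hsurj : Function.Surjective R.mulVec := by
    rw [← Matrix.coe_mulVecLin, ← LinearMap.range_eq_top]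
    refine Submodule.eq_top_of_finrank_eq ?_
    rw [Module.finrank_fin_fun]
    exact h
  obtain ⟨Z, hZ⟩ := Matrix.mulVec_surjective_iff_exists_right_inverse.1 hsurj
  refine ⟨fun k => Matrix.of fun i j => Z (k, i) j, ?_⟩
  rw [← hZ]
  ext i j
  rw [Matrix.sum_apply, Matrix.mul_apply, Fintype.sum_prod_type]
  rfl

theorem IsObservable.exists_left_inverse {A : Matrix (Fin n) (Fin n) ℝ}
    {C : Matrix (Fin m) (Fin n) ℝ} (h : IsObservable A C) :
    ∃ L : Fin n → Matrix (Fin n) (Fin m) ℝ, ∑ k : Fin n, L k * (C * A ^ (k : ℕ)) = 1 := by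
  obtain ⟨Y, hY⟩ := (isObservable_iff_isReachable_transpose.1 h).exists_right_inverse
  refine ⟨fun k => (Y k)ᵀ, ?_⟩
  have := congrArg Matrix.transpose hY
  rw [Matrix.transpose_sum, Matrix.transpose_one] at this
  rw [← this]
  refine Finset.sum_congr rfl fun k _ => ?_
  rw [Matrix.transpose_mul, Matrix.transpose_mul, Matrix.transpose_pow, Matrix.transpose_transpose,
    Matrix.transpose_transpose]

/-- Hankel matrix argument: the product of the observability and the reachability matrix contains
only Markov parameters, has rank `n`, and factors through the state space of any other
realization. -/
theorem isMinimal_of_isReachable_of_isObservable {A : Matrix (Fin n) (Fin n) ℝ}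
    {B : Matrix (Fin n) (Fin m) ℝ} {C : Matrix (Fin m) (Fin n) ℝ} (D : Matrix (Fin m) (Fin m) ℝ)
    (hr : IsReachable A B) (ho : IsObservable A C) : IsMinimal A B C D := by
  intro n' A' B' C' D' h
  obtain ⟨Y, hY⟩ := hr.exists_right_inverse
  obtain ⟨L, hL⟩ := ho.exists_left_inverse
  have hM : ∀ j : ℕ, C' * A' ^ j * B' = C * A ^ j * B := fun j =>
    congrFun (markov_eq_of_transferFunction_eq h) (j + 1)
  have h1 : (∑ k : Fin n, L k * (C' * A' ^ (k : ℕ))) *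
      (∑ k : Fin n, A' ^ (k : ℕ) * B' * Y k) = 1 := by
    have h2 : (∑ k : Fin n, L k * (C * A ^ (k : ℕ))) * (∑ k : Fin n, A ^ (k : ℕ) * B * Y k) = 1 := by
      rw [hY, hL, Matrix.mul_one]
    rw [← h2]
    simp only [Matrix.sum_mul, Matrix.mul_sum]
    refine Finset.sum_congr rfl fun i _ => Finset.sum_congr rfl fun j _ => ?_
    have := congrArg (fun M => L j * M * Y i) (hM (j + i))
    simpa only [pow_add, Matrix.mul_assoc] using this
  have h3 := Matrix.rank_mul_le_left (∑ k : Fin n, L k * (C' * A' ^ (k : ℕ)))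
    (∑ k : Fin n, A' ^ (k : ℕ) * B' * Y k)
  rw [h1, Matrix.rank_one, Fintype.card_fin] at h3
  exact h3.trans (Matrix.rank_le_width _)

/-- A realization intertwined with another one by `V` has the same transfer function. -/
theorem transferFunction_eq_of_intertwine {r : ℕ} {A : Matrix (Fin n) (Fin n) ℝ}
    {B : Matrix (Fin n) (Fin m) ℝ} (C : Matrix (Fin m) (Fin n) ℝ) (D : Matrix (Fin m) (Fin m) ℝ)
    {A' : Matrix (Fin r) (Fin r) ℝ} {B' : Matrix (Fin r) (Fin m) ℝ}
    {V : Matrix (Fin n) (Fin r) ℝ} (hA : A * V = V * A') (hB : B = V * B') :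
    transferFunction A' B' (C * V) D = transferFunction A B C D := by
  have h1 : (Matrix.scalar (Fin n) (RatFunc.X : RatFunc ℝ) - const A) * const V
      = const V * (Matrix.scalar (Fin r) (RatFunc.X : RatFunc ℝ) - const A') := by
    rw [Matrix.sub_mul, Matrix.mul_sub, ← const_mul, ← const_mul, hA, Matrix.scalar_apply,
      Matrix.scalar_apply, ← Matrix.smul_one_eq_diagonal, ← Matrix.smul_one_eq_diagonal,
      Matrix.smul_mul, Matrix.mul_smul, Matrix.one_mul, Matrix.mul_one]
  have h2 : const V * resolvent A' = resolvent A * const V := by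
    calc const V * resolvent A'
        = resolvent A * ((Matrix.scalar (Fin n) (RatFunc.X : RatFunc ℝ) - const A) * const V)
            * resolvent A' := by
          rw [← Matrix.mul_assoc (resolvent A), resolvent_mul_sub, Matrix.one_mul]
      _ = resolvent A * const V := by
          rw [h1, Matrix.mul_assoc, Matrix.mul_assoc, sub_mul_resolvent, Matrix.mul_one]
  rw [transferFunction_eq, transferFunction_eq, const_mul, Matrix.mul_assoc (const C), h2, hB,
    const_mul]
  simp only [Matrix.mul_assoc]

/-- A realization can be restricted to its reachable subspace. -/
theorem IsMinimal.isReachable {A : Matrix (Fin n) (Fin n) ℝ} {B : Matrix (Fin n) (Fin m) ℝ}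
    {C : Matrix (Fin m) (Fin n) ℝ} {D : Matrix (Fin m) (Fin m) ℝ} (h : IsMinimal A B C D) :
    IsReachable A B := by
  set S : Submodule ℝ (Fin n → ℝ) :=
    Submodule.span ℝ {v | ∃ (k : ℕ) (y : Fin m → ℝ), v = (A ^ k * B) *ᵥ y} with hS
  have hSA : ∀ v ∈ S, A *ᵥ v ∈ S := by
    intro v hv
    have hle : S ≤ S.comap A.mulVecLin := by
      rw [hS, Submodule.span_le]
      rintro _ ⟨k, y, rfl⟩
      refine Submodule.subset_span ⟨k + 1, y, ?_⟩
      rw [Matrix.mulVecLin_apply, Matrix.mulVec_mulVec, ← Matrix.mul_assoc, pow_succ']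
    exact hle hv
  have hSB : ∀ y, B *ᵥ y ∈ S := fun y => Submodule.subset_span ⟨0, y, by simp⟩
  let b := Module.finBasis ℝ S
  set V : Matrix (Fin n) (Fin (Module.finrank ℝ S)) ℝ :=
    Matrix.of fun i j => (b j : Fin n → ℝ) i with hV
  have hfactor : ∀ {l : ℕ} (M : Matrix (Fin n) (Fin l) ℝ), (∀ j, M.col j ∈ S) →
      ∃ M' : Matrix (Fin (Module.finrank ℝ S)) (Fin l) ℝ, M = V * M' := by
    intro l M hM
    refine ⟨Matrix.of fun i j => b.repr ⟨M.col j, hM j⟩ i, ?_⟩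
    ext i j
    have h1 := congrArg (fun v : S => (v : Fin n → ℝ) i) (b.sum_repr ⟨M.col j, hM j⟩)
    simp only [Submodule.coe_sum, Submodule.coe_smul, Finset.sum_apply, Pi.smul_apply,
      smul_eq_mul] at h1
    rw [Matrix.mul_apply]
    refine Eq.trans h1.symm (Finset.sum_congr rfl fun c _ => mul_comm _ _)
  obtain ⟨B', hB'⟩ := hfactor B fun j => by
    rw [← Matrix.mulVec_single_one]
    exact hSB _
  obtain ⟨A', hA'⟩ := hfactor (A * V) fun j => by
    have : (A * V).col j = A *ᵥ (b j : Fin n → ℝ) := rfl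
    rw [this]
    exact hSA _ (b j).2
  have hn := h _ A' B' (C * V) D (transferFunction_eq_of_intertwine C D hA' hB')
  have htop : S = ⊤ := by
    refine Submodule.eq_top_of_finrank_eq (le_antisymm (Submodule.finrank_le S) ?_)
    rwa [Module.finrank_fin_fun]
  refine isReachable_iff.2 fun x hx => ?_
  have hle : S ≤ LinearMap.ker (dotProductBilin ℝ ℝ x) := by
    rw [hS, Submodule.span_le]
    rintro _ ⟨k, y, rfl⟩
    have : x ⬝ᵥ ((A ^ k * B) *ᵥ y) = 0 := by
      rw [Matrix.dotProduct_mulVec, hx k, zero_dotProduct]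
    exact this
  have hx : x ⬝ᵥ x = 0 := hle (htop ▸ Submodule.mem_top : x ∈ S)
  exact dotProduct_self_eq_zero.1 hx

theorem IsMinimal.isObservable {A : Matrix (Fin n) (Fin n) ℝ} {B : Matrix (Fin n) (Fin m) ℝ}
    {C : Matrix (Fin m) (Fin n) ℝ} {D : Matrix (Fin m) (Fin m) ℝ} (h : IsMinimal A B C D) :
    IsObservable A C :=
  isObservable_iff_isReachable_transpose.2 h.transpose.isReachable

end Minimality

/-! ### The solution of (P) attached to a minimal all-pass function -/

section Existence

variable {n m : ℕ}

/-- The polynomial part of `z ^ j Q(z)`, with coefficients the first `j + 1` Markov parameters of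
`Q(z) = C (zI - A)⁻¹ B + D`. -/
def polyPart (A : Matrix (Fin n) (Fin n) ℝ) (B : Matrix (Fin n) (Fin m) ℝ)
    (C : Matrix (Fin m) (Fin n) ℝ) (D : Matrix (Fin m) (Fin m) ℝ) :
    ℕ → Matrix (Fin m) (Fin m) (RatFunc ℝ)
  | 0 => const (markov A B C D 0)
  | j + 1 => (RatFunc.X : RatFunc ℝ) • polyPart A B C D j + const (markov A B C D (j + 1))

variable (A : Matrix (Fin n) (Fin n) ℝ) (B : Matrix (Fin n) (Fin m) ℝ)
  (C : Matrix (Fin m) (Fin n) ℝ) (D : Matrix (Fin m) (Fin m) ℝ)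

theorem X_pow_smul_transferFunction (j : ℕ) :
    (RatFunc.X : RatFunc ℝ) ^ j • transferFunction A B C D
      = const (C * A ^ j) * (resolvent A * const B) + polyPart A B C D j := by
  induction j with
  | zero => simp [transferFunction_eq, polyPart, markov, Matrix.mul_assoc]
  | succ j ih =>
    rw [pow_succ', mul_smul, ih, smul_add, ← Matrix.mul_smul, ← Matrix.smul_mul,
      X_smul_resolvent, polyPart, markov, pow_succ, const_mul, const_mul, const_mul, const_mul,
      const_mul]
    simp only [Matrix.add_mul, Matrix.mul_add, Matrix.one_mul, Matrix.mul_assoc]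
    abel

/-- The Laurent coefficients of `(polynomial part of z ^ j Q(z)) Q(z⁻¹)ᵀ`. -/
def gram (j : ℕ) (d : ℤ) : Matrix (Fin m) (Fin m) ℝ :=
  coeffMatrix d (polyPart A B C D j * paraConj (transferFunction A B C D))

/-- The Laurent coefficients of `(zI - A)⁻¹ B Q(z⁻¹)ᵀ`. -/
def stateCoeff (d : ℤ) : Matrix (Fin n) (Fin m) ℝ :=
  coeffMatrix d (resolvent A * const B * paraConj (transferFunction A B C D))

theorem coeffMatrix_paraConj (j : ℕ) :
    coeffMatrix j (paraConj (transferFunction A B C D)) = (markov A B C D j)ᵀ := by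
  rw [← coeffMatrix_invSubst_transferFunction]
  rfl

theorem coeffMatrix_paraConj_neg {d : ℤ} (hd : d < 0) :
    coeffMatrix d (paraConj (transferFunction A B C D)) = 0 := by
  rw [← Matrix.transpose_eq_zero, ← coeffMatrix_invSubst_transferFunction_neg A B C D hd]
  rfl

theorem gram_zero (d : ℤ) :
    gram A B C D 0 d = D * coeffMatrix d (paraConj (transferFunction A B C D)) := by
  rw [gram, polyPart, coeffMatrix_const_mul, markov]

theorem gram_succ (j : ℕ) (d : ℤ) :
    gram A B C D (j + 1) d = gram A B C D j (d - 1)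
      + markov A B C D (j + 1) * coeffMatrix d (paraConj (transferFunction A B C D)) := by
  rw [gram, polyPart, Matrix.add_mul, coeffMatrix_add, Matrix.smul_mul, coeffMatrix_X_smul,
    coeffMatrix_const_mul, gram]

theorem gram_neg (j : ℕ) {d : ℤ} (hd : d < 0) : gram A B C D j d = 0 := by
  induction j generalizing d with
  | zero => rw [gram_zero, coeffMatrix_paraConj_neg A B C D hd, Matrix.mul_zero]
  | succ j ih =>
    rw [gram_succ, ih (by omega), coeffMatrix_paraConj_neg A B C D hd, Matrix.mul_zero, add_zero]

theorem gram_transpose (j k : ℕ) : (gram A B C D j k)ᵀ = gram A B C D k j := by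
  induction j generalizing k with
  | zero =>
    cases k with
    | zero =>
      rw [gram_zero, coeffMatrix_paraConj, Matrix.transpose_mul, Matrix.transpose_transpose, markov]
    | succ k =>
      rw [gram_zero, gram_succ, coeffMatrix_paraConj, coeffMatrix_paraConj, gram_neg _ _ _ _ _
        (by simp), Matrix.transpose_mul, Matrix.transpose_transpose, zero_add, markov]
  | succ j ih =>
    cases k with
    | zero =>
      rw [gram_zero, gram_succ, coeffMatrix_paraConj, coeffMatrix_paraConj, gram_neg _ _ _ _ _
        (by simp), Matrix.transpose_add, Matrix.transpose_mul, Matrix.transpose_transpose,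
        Matrix.transpose_zero, zero_add, markov]
    | succ k =>
      rw [gram_succ, gram_succ, coeffMatrix_paraConj, coeffMatrix_paraConj, Matrix.transpose_add,
        Matrix.transpose_mul, Matrix.transpose_transpose, Nat.cast_succ, Nat.cast_succ,
        add_sub_cancel_right, add_sub_cancel_right, ih]

variable {A B C D}

/-- The step where the all-pass property enters: `z ^ j Q(z) Q(z⁻¹)ᵀ = z ^ j I`. -/
theorem gram_eq (h : IsAllPass (transferFunction A B C D)) (j : ℕ) (d : ℤ) :
    gram A B C D j d = (if d = j then 1 else 0) - C * A ^ j * stateCoeff A B C D d := by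
  have h1 := congrArg (fun M => coeffMatrix d (M * paraConj (transferFunction A B C D)))
    (X_pow_smul_transferFunction A B C D j)
  simp only [Matrix.smul_mul, Matrix.add_mul] at h1
  rw [show transferFunction A B C D * paraConj (transferFunction A B C D) = 1 from h,
    coeffMatrix_X_pow_smul, coeffMatrix_one, coeffMatrix_add, Matrix.mul_assoc,
    coeffMatrix_const_mul] at h1
  rw [gram, stateCoeff, eq_sub_iff_add_eq, add_comm, ← h1]
  simp [sub_eq_zero]

theorem stateCoeff_neg_one (h : IsAllPass (transferFunction A B C D)) (ho : IsObservable A C) :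
    stateCoeff A B C D (-1) = 0 := by
  refine ho.eq_zero_of_forall_mul_eq_zero fun j => ?_
  have h1 := gram_eq h j (-1)
  rw [gram_neg _ _ _ _ _ (by simp), if_neg (by omega), zero_sub] at h1
  exact neg_eq_zero.1 h1.symm

theorem stateCoeff_sub_one (d : ℤ) :
    stateCoeff A B C D (d - 1) = A * stateCoeff A B C D d
      + B * coeffMatrix d (paraConj (transferFunction A B C D)) := by
  rw [stateCoeff, ← coeffMatrix_X_smul, ← Matrix.smul_mul, ← Matrix.smul_mul, X_smul_resolvent,
    Matrix.add_mul, Matrix.one_mul, Matrix.add_mul, coeffMatrix_add, Matrix.mul_assoc (const A),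
    Matrix.mul_assoc (const A), coeffMatrix_const_mul, coeffMatrix_const_mul, add_comm, stateCoeff]

theorem mul_stateCoeff (h : IsAllPass (transferFunction A B C D)) (j k : ℕ) :
    C * A ^ j * stateCoeff A B C D k = (C * A ^ k * stateCoeff A B C D j)ᵀ := by
  have h1 := gram_transpose A B C D k j
  rw [gram_eq h, gram_eq h, Matrix.transpose_sub] at h1
  have h2 : (if (k : ℤ) = j then 1 else 0 : Matrix (Fin m) (Fin m) ℝ)
      = (if (j : ℤ) = k then 1 else 0 : Matrix (Fin m) (Fin m) ℝ)ᵀ := by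
    by_cases hjk : (k : ℤ) = j
    · rw [if_pos hjk, if_pos hjk.symm, Matrix.transpose_one]
    · rw [if_neg hjk, if_neg (Ne.symm hjk), Matrix.transpose_zero]
  rw [h2] at h1
  exact (sub_right_inj.1 h1).symm

/-- The state coefficients of an all-pass function are `-P (Aᵀ) ^ k Cᵀ` with a constant symmetric
matrix `P`, because the moments `C A ^ j stateCoeff k` are symmetric in `j` and `k`. -/
theorem exists_isSymm_stateCoeff_eq (h : IsAllPass (transferFunction A B C D))
    (ho : IsObservable A C) :
    ∃ P : Matrix (Fin n) (Fin n) ℝ, P.IsSymm ∧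
      ∀ k : ℕ, stateCoeff A B C D k = -(P * (Aᵀ ^ k * Cᵀ)) := by
  obtain ⟨L, hL⟩ := ho.exists_left_inverse
  have hF : ∀ k : ℕ, stateCoeff A B C D k
      = -((-∑ i : Fin n, L i * (stateCoeff A B C D (i : ℕ))ᵀ) * (Aᵀ ^ k * Cᵀ)) := by
    intro k
    rw [Matrix.neg_mul, neg_neg, Matrix.sum_mul]
    calc stateCoeff A B C D k
        = (∑ i : Fin n, L i * (C * A ^ (i : ℕ))) * stateCoeff A B C D k := by
          rw [hL, Matrix.one_mul]
      _ = ∑ i : Fin n, L i * (stateCoeff A B C D (i : ℕ))ᵀ * (Aᵀ ^ k * Cᵀ) := by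
          rw [Matrix.sum_mul]
          refine Finset.sum_congr rfl fun i _ => ?_
          rw [Matrix.mul_assoc, mul_stateCoeff h, Matrix.transpose_mul, Matrix.transpose_mul,
            Matrix.transpose_pow, Matrix.mul_assoc]
  refine ⟨_, ?_, hF⟩
  set P := -∑ i : Fin n, L i * (stateCoeff A B C D (i : ℕ))ᵀ 
  have hr := isObservable_iff_isReachable_transpose.1 ho
  have h1 : Pᵀ - P = 0 := by
    refine hr.eq_zero_of_forall_mul_eq_zero fun k => ?_
    refine ho.eq_zero_of_forall_mul_eq_zero fun j => ?_
    have h2 := mul_stateCoeff h j k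
    rw [hF k, hF j] at h2
    simp only [Matrix.mul_neg, Matrix.transpose_neg, Matrix.transpose_mul, Matrix.transpose_pow,
      Matrix.transpose_transpose, neg_inj] at h2
    simp only [Matrix.sub_mul, Matrix.mul_sub, sub_eq_zero]
    simp only [Matrix.mul_assoc] at h2 ⊢
    exact h2.symm
  exact sub_eq_zero.1 h1

theorem exists_isSymm_solvesP (h : IsAllPass (transferFunction A B C D))
    (ho : IsObservable A C) : ∃ P : Matrix (Fin n) (Fin n) ℝ, P.IsSymm ∧ SolvesP A B C D P := by
  obtain ⟨P, hP, hF⟩ := exists_isSymm_stateCoeff_eq h ho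
  have hr := isObservable_iff_isReachable_transpose.1 ho
  refine ⟨P, hP, ?_, ?_, ?_⟩
  · rw [← sub_eq_zero]
    refine hr.eq_zero_of_forall_mul_eq_zero fun k => ?_
    have h1 := stateCoeff_sub_one (A := A) (B := B) (C := C) (D := D) ((k + 1 : ℕ) : ℤ)
    rw [coeffMatrix_paraConj, hF, Nat.cast_succ, add_sub_cancel_right, hF, markov,
      Matrix.transpose_mul, Matrix.transpose_mul, Matrix.transpose_pow, pow_succ'] at h1
    simp only [Matrix.sub_mul, Matrix.mul_assoc, Matrix.mul_neg] at h1 ⊢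
    rw [neg_eq_iff_eq_neg] at h1
    rw [h1]
    abel
  · have h1 := stateCoeff_sub_one (A := A) (B := B) (C := C) (D := D) ((0 : ℕ) : ℤ)
    rw [coeffMatrix_paraConj, hF, Nat.cast_zero, zero_sub, stateCoeff_neg_one h ho, markov,
      pow_zero, Matrix.one_mul] at h1
    rw [h1, Matrix.mul_neg, ← Matrix.mul_assoc]
    abel
  · have h1 := gram_eq h 0 ((0 : ℕ) : ℤ)
    rw [gram_zero, coeffMatrix_paraConj, hF, markov, if_pos rfl] at h1
    rw [h1]
    simp [Matrix.mul_assoc]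

end Existence

/-! ### Maximal positive subspaces -/

section Krein

/-- If `U` is a positive definite subspace of maximal dimension, then every vector orthogonal to
`U` on which the form is nonnegative lies in the radical: the form is negative semidefinite on
`Uᗮ`, so the Cauchy–Schwarz inequality applies there. -/
theorem eq_zero_of_orthogonal_of_maximal {V : Type*} [AddCommGroup V] [Module ℝ V]
    [FiniteDimensional ℝ V] (β : LinearMap.BilinForm ℝ V) (hβ : β.IsSymm) (U : Submodule ℝ V)
    (hU : ∀ u ∈ U, u ≠ 0 → 0 < β u u)
    (hmax : ∀ W : Submodule ℝ V, (∀ w ∈ W, w ≠ 0 → 0 < β w w) →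
      Module.finrank ℝ W ≤ Module.finrank ℝ U)
    {v : V} (hv : ∀ u ∈ U, β u v = 0) (hv0 : 0 ≤ β v v) (w : V) : β v w = 0 := by
  have hsymm : ∀ x y, β x y = β y x := fun x y => hβ.eq x y
  have hneg : ∀ y : V, (∀ u ∈ U, β u y = 0) → β y y ≤ 0 := by
    intro y hy
    by_contra hpos
    push Not at hpos
    have hyU : y ∉ U := fun h => hpos.ne' (hy y h)
    have hlt : U < U ⊔ Submodule.span ℝ {y} := by
      refine lt_of_le_of_ne le_sup_left fun h => hyU ?_
      rw [h]
      exact (le_sup_right : _ ≤ U ⊔ Submodule.span ℝ {y}) (Submodule.mem_span_singleton_self y)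
    refine absurd (hmax (U ⊔ Submodule.span ℝ {y}) ?_)
      (not_le.2 (Submodule.finrank_lt_finrank_of_lt hlt))
    intro w hw hw0
    obtain ⟨u, hu, z, hz, rfl⟩ := Submodule.mem_sup.1 hw
    obtain ⟨t, rfl⟩ := Submodule.mem_span_singleton.1 hz
    have hexp : β (u + t • y) (u + t • y) = β u u + t ^ 2 * β y y := by
      simp only [map_add, map_smul, LinearMap.add_apply, LinearMap.smul_apply, smul_eq_mul,
        hsymm y u, hy u hu]
      ring
    rw [hexp]
    by_cases hu0 : u = 0
    · have ht : t ≠ 0 := by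
        rintro rfl
        simp [hu0] at hw0
      rw [hu0, map_zero, zero_add]
      positivity
    · have := hU u hu hu0
      positivity
  have hdisj : Disjoint U (β.orthogonal U) := by
    rw [Submodule.disjoint_def]
    intro x hx hx'
    by_contra hx0
    exact (hU x hx hx0).ne' (hx' x hx)
  have hcompl : IsCompl U (β.orthogonal U) :=
    (LinearMap.BilinForm.isCompl_orthogonal_iff_disjoint hβ.isRefl).2 hdisj
  obtain ⟨u, hu, y, hy, rfl⟩ := Submodule.mem_sup.1
    (hcompl.sup_eq_top ▸ Submodule.mem_top : w ∈ U ⊔ β.orthogonal U)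
  have hy' : ∀ u ∈ U, β u y = 0 := hy
  rw [map_add, hsymm v u, hv u hu, zero_add]
  have hyy := hneg y hy'
  -- The value of `t` for which `2 t c + t² d ≤ 0` with `d ≤ 0` forces `c = 0`.
  set c := β v y with hc
  set d := β y y with hd
  set t := c / (1 - d) with ht
  have h1 := hneg (v + t • y) fun u hu => by
    rw [map_add, map_smul, hv u hu, hy' u hu, smul_zero, add_zero]
  have hexp : β (v + t • y) (v + t • y) = β v v + 2 * t * c + t ^ 2 * d := by
    simp only [map_add, map_smul, LinearMap.add_apply, LinearMap.smul_apply, smul_eq_mul,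
      hsymm y v, ← hc, ← hd]
    ring
  have htc : c = t * (1 - d) := by
    rw [ht, div_mul_cancel₀]
    linarith
  have h2 : t ^ 2 * (2 - d) ≤ 0 := by
    have h3 : 2 * t * c + t ^ 2 * d = t ^ 2 * (2 - d) := by
      linear_combination (2 * t) * htc
    linarith
  have ht0 : t = 0 := by
    by_contra h
    have : 0 < t ^ 2 * (2 - d) := mul_pos (by positivity) (by linarith)
    linarith
  rw [htc, ht0, zero_mul]

variable {n m : ℕ}

theorem mulVec_dotProduct_of_isSymm {P : Matrix (Fin n) (Fin n) ℝ} (hP : P.IsSymm)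
    (x y : Fin n → ℝ) : (P *ᵥ x) ⬝ᵥ y = x ⬝ᵥ P *ᵥ y := by
  rw [Matrix.dotProduct_mulVec, ← Matrix.mulVec_transpose, hP.eq]

/-- The indefinite form `x ⬝ P y - b ⬝ c` on `ℝⁿ × ℝᵐ`. -/
def kreinForm (m : ℕ) (P : Matrix (Fin n) (Fin n) ℝ) :
    LinearMap.BilinForm ℝ ((Fin n → ℝ) × (Fin m → ℝ)) :=
  LinearMap.mk₂ ℝ (fun v w => v.1 ⬝ᵥ P *ᵥ w.1 - v.2 ⬝ᵥ w.2)
    (fun _ _ _ => by simp [add_dotProduct]; ring)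
    (fun _ _ _ => by simp [smul_dotProduct]; ring)
    (fun _ _ _ => by simp [Matrix.mulVec_add, dotProduct_add]; ring)
    (fun _ _ _ => by simp [Matrix.mulVec_smul, dotProduct_smul]; ring)

theorem kreinForm_apply (P : Matrix (Fin n) (Fin n) ℝ) (v w : (Fin n → ℝ) × (Fin m → ℝ)) :
    kreinForm m P v w = v.1 ⬝ᵥ P *ᵥ w.1 - v.2 ⬝ᵥ w.2 := rfl

theorem kreinForm_isSymm {P : Matrix (Fin n) (Fin n) ℝ} (hP : P.IsSymm) :
    (kreinForm m P).IsSymm := by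
  refine ⟨fun v w => ?_⟩
  rw [kreinForm_apply, kreinForm_apply, dotProduct_comm v.2,
    ← mulVec_dotProduct_of_isSymm hP, dotProduct_comm]

/-- If `A P Aᵀ - P = B Bᵀ`, then `x ↦ (Aᵀ x, Bᵀ x)` is an isometry from the form `P` to
`kreinForm m P`, two forms with the same positive index. A vector orthogonal to the range of this
isometry on which `kreinForm m P` is nonnegative therefore lies in the radical. -/
theorem kreinForm_orthogonal_radical {A P : Matrix (Fin n) (Fin n) ℝ}
    {B : Matrix (Fin n) (Fin m) ℝ} (hP : P.IsSymm) (h : A * P * Aᵀ - P = B * Bᵀ)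
    {x : Fin n → ℝ} {b : Fin m → ℝ} (hL : A *ᵥ P *ᵥ x = B *ᵥ b) (h0 : b ⬝ᵥ b ≤ x ⬝ᵥ P *ᵥ x) :
    P *ᵥ x = 0 ∧ b = 0 := by
  -- A subspace `U` of `ℝⁿ` of maximal dimension on which `P` is positive definite.
  obtain ⟨U, hUr, hUpos⟩ :=
    exists_finrank_eq_sigPos_and_posDef (Matrix.toBilin' P).toQuadraticMap
  have hUpos' : ∀ u ∈ U, u ≠ 0 → 0 < u ⬝ᵥ P *ᵥ u := by
    intro u hu hu0
    have := hUpos ⟨u, hu⟩ (by simpa using hu0)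
    simpa [Matrix.toBilin'_apply'] using this
  have hUmax : ∀ W : Submodule ℝ (Fin n → ℝ), (∀ w ∈ W, w ≠ 0 → 0 < w ⬝ᵥ P *ᵥ w) →
      Module.finrank ℝ W ≤ Module.finrank ℝ U := by
    intro W hW
    rw [hUr]
    refine le_sigPos_of_posDef _ ?_
    rintro ⟨w, hw⟩ hw0
    have := hW w hw (by simpa using hw0)
    simpa [Matrix.toBilin'_apply'] using this
  let τ : (Fin n → ℝ) →ₗ[ℝ] (Fin n → ℝ) × (Fin m → ℝ) := Aᵀ.mulVecLin.prod Bᵀ.mulVecLin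
  have hτ : ∀ y (v : (Fin n → ℝ) × (Fin m → ℝ)),
      kreinForm m P (τ y) v = y ⬝ᵥ (A *ᵥ P *ᵥ v.1 - B *ᵥ v.2) := by
    intro y v
    rw [kreinForm_apply, dotProduct_sub, Matrix.dotProduct_mulVec y A, Matrix.dotProduct_mulVec y B]
    simp [τ]
  have hττ : ∀ y, kreinForm m P (τ y) (τ y) = y ⬝ᵥ P *ᵥ y := by
    intro y
    rw [hτ]
    have h1 : A *ᵥ P *ᵥ (τ y).1 - B *ᵥ (τ y).2 = P *ᵥ y := by
      change A *ᵥ P *ᵥ Aᵀ *ᵥ y - B *ᵥ Bᵀ *ᵥ y = P *ᵥ y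
      rw [Matrix.mulVec_mulVec, Matrix.mulVec_mulVec, Matrix.mulVec_mulVec, ← h,
        ← Matrix.sub_mulVec, sub_sub_cancel]
    rw [h1]
  have hτinj : ∀ u ∈ U, τ u = 0 → u = 0 := by
    intro u hu hu0
    by_contra hne
    have h1 := hUpos' u hu hne
    rw [← hττ u, hu0, map_zero] at h1
    exact lt_irrefl _ h1
  have hfin : Module.finrank ℝ (U.map τ) = Module.finrank ℝ U := by
    have hinj : Function.Injective (τ.domRestrict U) := by
      rw [← LinearMap.ker_eq_bot, LinearMap.ker_eq_bot']
      intro u hu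
      exact Subtype.ext (hτinj u u.2 hu)
    rw [← LinearMap.range_domRestrict, LinearMap.finrank_range_of_inj hinj]
  have hmap : ∀ u ∈ U.map τ, u ≠ 0 → 0 < kreinForm m P u u := by
    rintro _ ⟨u, hu, rfl⟩ hu0
    rw [hττ]
    exact hUpos' u hu fun h => hu0 (by rw [h, map_zero])
  -- Projection to `ℝⁿ` embeds the positive subspaces of the form on `ℝⁿ × ℝᵐ`.
  have hmax : ∀ W : Submodule ℝ ((Fin n → ℝ) × (Fin m → ℝ)),
      (∀ w ∈ W, w ≠ 0 → 0 < kreinForm m P w w) →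
      Module.finrank ℝ W ≤ Module.finrank ℝ (U.map τ) := by
    intro W hW
    have hsq : ∀ c : Fin m → ℝ, 0 ≤ c ⬝ᵥ c := fun c =>
      Finset.sum_nonneg fun i _ => mul_self_nonneg _
    have hinj : Function.Injective ((LinearMap.fst ℝ (Fin n → ℝ) (Fin m → ℝ)).domRestrict W) := by
      rw [← LinearMap.ker_eq_bot, LinearMap.ker_eq_bot']
      rintro ⟨⟨y, c⟩, hw⟩ hy
      have hy : y = 0 := hy
      by_contra hne
      have h1 := hW _ hw fun h => hne (Subtype.ext h)
      rw [kreinForm_apply, hy, zero_dotProduct, zero_sub] at h1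
      linarith [hsq c]
    have h1 : Module.finrank ℝ W
        = Module.finrank ℝ (W.map (LinearMap.fst ℝ (Fin n → ℝ) (Fin m → ℝ))) := by
      rw [← LinearMap.range_domRestrict, LinearMap.finrank_range_of_inj hinj]
    rw [h1, hfin]
    refine hUmax _ ?_
    rintro _ ⟨⟨y, c⟩, hw, rfl⟩ hy
    have h2 := hW _ hw fun h => hy (by rw [h, map_zero])
    rw [kreinForm_apply] at h2
    have := hsq c
    simp only [LinearMap.fst_apply] at h2 ⊢
    linarith
  have hrad := eq_zero_of_orthogonal_of_maximal (kreinForm m P) (kreinForm_isSymm hP) (U.map τ)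
    hmap hmax (v := (x, b)) (by
      rintro _ ⟨u, -, rfl⟩
      rw [hτ, hL, sub_self, dotProduct_zero]) (by rw [kreinForm_apply]; linarith)
  constructor
  · have h1 := hrad (P *ᵥ x, 0)
    rw [kreinForm_apply, dotProduct_zero, sub_zero, ← mulVec_dotProduct_of_isSymm hP] at h1
    exact dotProduct_self_eq_zero.1 h1
  · have h1 := hrad (0, b)
    rw [kreinForm_apply, Matrix.mulVec_zero, dotProduct_zero, zero_sub, neg_eq_zero] at h1
    exact dotProduct_self_eq_zero.1 h1

/-- The kernel of a symmetric solution of `A P Aᵀ - P = B Bᵀ` is invariant under `Aᵀ` and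
annihilated by `Bᵀ`. -/
theorem isUnit_of_isReachable {A P : Matrix (Fin n) (Fin n) ℝ}
    {B : Matrix (Fin n) (Fin m) ℝ} (hr : IsReachable A B) (hP : P.IsSymm)
    (h : A * P * Aᵀ - P = B * Bᵀ) : IsUnit P := by
  have hstep : ∀ x, P *ᵥ x = 0 → P *ᵥ Aᵀ *ᵥ x = 0 ∧ Bᵀ *ᵥ x = 0 := by
    intro x hx
    have h1 : A *ᵥ P *ᵥ Aᵀ *ᵥ x = B *ᵥ Bᵀ *ᵥ x := by
      have h2 := congrArg (fun M => M *ᵥ x) h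
      simp only [Matrix.sub_mulVec, hx, sub_zero, ← Matrix.mulVec_mulVec] at h2
      exact h2
    refine kreinForm_orthogonal_radical hP h h1 (le_of_eq ?_)
    rw [Matrix.mulVec_transpose, Matrix.mulVec_transpose, ← Matrix.dotProduct_mulVec,
      ← Matrix.dotProduct_mulVec, ← Matrix.mulVec_transpose, ← Matrix.mulVec_transpose, h1]
  have hker : ∀ x, P *ᵥ x = 0 → ∀ k : ℕ, P *ᵥ (Aᵀ ^ k *ᵥ x) = 0 := by
    intro x hx k
    induction k with
    | zero => simpa using hx
    | succ k ih =>
      rw [pow_succ', ← Matrix.mulVec_mulVec]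
      exact (hstep _ ih).1
  rw [← Matrix.mulVec_injective_iff_isUnit, ← Matrix.coe_mulVecLin, ← LinearMap.ker_eq_bot,
    LinearMap.ker_eq_bot']
  intro x hx
  refine isReachable_iff.1 hr x fun k => ?_
  rw [← Matrix.mulVec_transpose, Matrix.transpose_mul, Matrix.transpose_pow,
    ← Matrix.mulVec_mulVec]
  exact (hstep _ (hker x hx k)).2

/-- A nonsingular solution of `A P Aᵀ - P = B Bᵀ` is completed to a solution of (P): the orthogonal
complement of the range of `x ↦ (Aᵀ x, Bᵀ x)` is negative definite of dimension `m`, and the rows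
of `[C D]` are an orthonormal basis of it. -/
theorem exists_solvesP {A P : Matrix (Fin n) (Fin n) ℝ} {B : Matrix (Fin n) (Fin m) ℝ}
    (hP : P.IsSymm) (hPu : IsUnit P) (h : A * P * Aᵀ - P = B * Bᵀ) :
    ∃ (C : Matrix (Fin m) (Fin n) ℝ) (D : Matrix (Fin m) (Fin m) ℝ), SolvesP A B C D P := by
  have hdet : IsUnit P.det := (Matrix.isUnit_iff_isUnit_det P).1 hPu
  let σ : (Fin n → ℝ) × (Fin m → ℝ) →ₗ[ℝ] (Fin n → ℝ) :=
    (A * P).mulVecLin.coprod (-B).mulVecLin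
  have hσ : ∀ v, σ v = A *ᵥ P *ᵥ v.1 - B *ᵥ v.2 := by
    intro v
    simp [σ, LinearMap.coprod_apply, sub_eq_add_neg]
  have hsurj : LinearMap.range σ = ⊤ := by
    rw [LinearMap.range_eq_top]
    intro y
    refine ⟨(Aᵀ *ᵥ P⁻¹ *ᵥ y, Bᵀ *ᵥ P⁻¹ *ᵥ y), ?_⟩
    rw [hσ]
    change A *ᵥ P *ᵥ Aᵀ *ᵥ P⁻¹ *ᵥ y - B *ᵥ Bᵀ *ᵥ P⁻¹ *ᵥ y = y
    rw [Matrix.mulVec_mulVec, Matrix.mulVec_mulVec _ (A * P), Matrix.mulVec_mulVec _ B, ← h,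
      ← Matrix.sub_mulVec, sub_sub_cancel, Matrix.mulVec_mulVec, Matrix.mul_nonsing_inv _ hdet,
      Matrix.one_mulVec]
  have hfin : Module.finrank ℝ (LinearMap.ker σ) = m := by
    have h1 := LinearMap.finrank_range_add_finrank_ker σ
    rw [hsurj, finrank_top, Module.finrank_prod, Module.finrank_fin_fun,
      Module.finrank_fin_fun] at h1
    omega
  let b := Module.finBasisOfFinrankEq ℝ (LinearMap.ker σ) hfin
  set C₀ : Matrix (Fin m) (Fin n) ℝ := Matrix.of fun i => (b i).1.1 with hC₀
  set D₀ : Matrix (Fin m) (Fin m) ℝ := Matrix.of fun i => (b i).1.2 with hD₀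
  have h2 : B * D₀ᵀ - A * P * C₀ᵀ = 0 := by
    ext i j
    have h3 : A *ᵥ P *ᵥ (b j).1.1 - B *ᵥ (b j).1.2 = 0 := by
      rw [← hσ]
      exact (b j).2
    have h4 := congrFun (sub_eq_zero.1 h3) i
    rw [Matrix.mulVec_mulVec] at h4
    rw [Matrix.sub_apply, Matrix.zero_apply, sub_eq_zero]
    exact h4.symm
  have hcomb : ∀ x : Fin m → ℝ, ((∑ i, x i • b i : LinearMap.ker σ) : (Fin n → ℝ) × (Fin m → ℝ))
      = (C₀ᵀ *ᵥ x, D₀ᵀ *ᵥ x) := by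
    intro x
    rw [Submodule.coe_sum]
    refine Prod.ext ?_ ?_
    · rw [Prod.fst_sum]
      funext j
      simp [Matrix.mulVec, dotProduct, hC₀, mul_comm]
    · rw [Prod.snd_sum]
      funext j
      simp [Matrix.mulVec, dotProduct, hD₀, mul_comm]
  have hpos : (D₀ * D₀ᵀ - C₀ * P * C₀ᵀ).PosDef := by
    refine Matrix.PosDef.of_dotProduct_mulVec_pos ?_ ?_
    · rw [Matrix.IsHermitian, Matrix.conjTranspose_eq_transpose_of_trivial]
      simp [Matrix.transpose_mul, Matrix.mul_assoc, hP.eq]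
    · intro x hx
      have h3 : star x ⬝ᵥ (D₀ * D₀ᵀ - C₀ * P * C₀ᵀ) *ᵥ x
          = (D₀ᵀ *ᵥ x) ⬝ᵥ (D₀ᵀ *ᵥ x) - (C₀ᵀ *ᵥ x) ⬝ᵥ P *ᵥ (C₀ᵀ *ᵥ x) := by
        rw [star_trivial, Matrix.sub_mulVec, dotProduct_sub, Matrix.mul_assoc,
          ← Matrix.mulVec_mulVec, ← Matrix.mulVec_mulVec, ← Matrix.mulVec_mulVec,
          Matrix.dotProduct_mulVec x, Matrix.dotProduct_mulVec x, Matrix.mulVec_transpose,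
          Matrix.mulVec_transpose]
      rw [h3, sub_pos]
      by_contra hle
      push Not at hle
      have hmem := (∑ i, x i • b i : LinearMap.ker σ).2
      rw [hcomb, LinearMap.mem_ker, hσ, sub_eq_zero] at hmem
      obtain ⟨h4, h5⟩ := kreinForm_orthogonal_radical hP h hmem hle
      have h6 : C₀ᵀ *ᵥ x = 0 :=
        Matrix.mulVec_injective_iff_isUnit.2 hPu (h4.trans (Matrix.mulVec_zero P).symm)
      have h7 : ∑ i, x i • b i = 0 := by
        refine Subtype.ext ?_
        rw [hcomb]
        exact Prod.ext h6 h5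
      exact hx (funext fun i => Fintype.linearIndependent_iff.1 b.linearIndependent x h7 i)
  obtain ⟨S, hS, hSS⟩ : ∃ S : Matrix (Fin m) (Fin m) ℝ, IsUnit S ∧
      D₀ * D₀ᵀ - C₀ * P * C₀ᵀ = S * Sᵀ := by
    open scoped MatrixOrder Matrix.Norms.L2Operator in
    obtain ⟨S, hS, hSS⟩ :=
      CStarAlgebra.isStrictlyPositive_iff_eq_mul_star_self.1 hpos.isStrictlyPositive
    refine ⟨S, hS, ?_⟩
    rwa [Matrix.star_eq_conjTranspose, Matrix.conjTranspose_eq_transpose_of_trivial] at hSS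
  have hSdet : IsUnit S.det := (Matrix.isUnit_iff_isUnit_det S).1 hS
  refine ⟨S⁻¹ * C₀, S⁻¹ * D₀, h, ?_, ?_⟩
  · rw [Matrix.transpose_mul, Matrix.transpose_mul, ← Matrix.mul_assoc, ← Matrix.mul_assoc,
      ← Matrix.sub_mul, h2, Matrix.zero_mul]
  · have h3 : S⁻¹ * D₀ * (S⁻¹ * D₀)ᵀ - S⁻¹ * C₀ * P * (S⁻¹ * C₀)ᵀ
        = S⁻¹ * (D₀ * D₀ᵀ - C₀ * P * C₀ᵀ) * (S⁻¹)ᵀ := by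
      simp only [Matrix.transpose_mul, Matrix.mul_sub, Matrix.sub_mul, Matrix.mul_assoc]
    rw [h3, hSS, ← Matrix.mul_assoc, Matrix.nonsing_inv_mul _ hSdet, Matrix.one_mul,
      ← Matrix.transpose_mul, Matrix.nonsing_inv_mul _ hSdet, Matrix.transpose_one]

end Krein

/-! ### Solutions of (P) and (Q) -/

section Equations

variable {n m : ℕ} {A : Matrix (Fin n) (Fin n) ℝ} {B : Matrix (Fin n) (Fin m) ℝ}
  {C : Matrix (Fin m) (Fin n) ℝ} {D : Matrix (Fin m) (Fin m) ℝ}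

/-- The equations (Q) are the equations (P) of the transposed realization. -/
theorem solvesQ_iff_solvesP_transpose {Q : Matrix (Fin n) (Fin n) ℝ} :
    SolvesQ A B C D Q ↔ SolvesP Aᵀ Cᵀ Bᵀ Dᵀ Q := by
  simp only [SolvesQ, SolvesP, Matrix.transpose_transpose]

theorem solvesP_iff_solvesQ_transpose {P : Matrix (Fin n) (Fin n) ℝ} :
    SolvesP A B C D P ↔ SolvesQ Aᵀ Cᵀ Bᵀ Dᵀ P := by
  simp only [SolvesQ, SolvesP, Matrix.transpose_transpose]

/-- If `Δ = A Δ Aᵀ`, then the columns of `Δ` lie in the range of every power of `A`, and `A` is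
injective on the intersection of these ranges. -/
theorem mul_eq_zero_of_mul_mul_transpose_eq {l : ℕ} {Δ : Matrix (Fin n) (Fin n) ℝ}
    (h : A * Δ * Aᵀ = Δ) {X : Matrix (Fin n) (Fin l) ℝ} (hX : A * (Δ * X) = 0) : Δ * X = 0 := by
  have hpow : ∀ k : ℕ, A ^ k * Δ * Aᵀ ^ k = Δ := by
    intro k
    induction k with
    | zero => simp
    | succ k ih =>
      have h1 : A ^ (k + 1) * Δ * Aᵀ ^ (k + 1) = A ^ k * (A * Δ * Aᵀ) * Aᵀ ^ k := by
        rw [pow_succ, pow_succ']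
        simp only [Matrix.mul_assoc]
      rw [h1, h, ih]
  obtain ⟨k, hk, hk1⟩ := ((Module.End.eventually_disjoint_ker_pow_range_pow
    (Matrix.toLin' A : Module.End ℝ (Fin n → ℝ))).and (Filter.eventually_ge_atTop 1)).exists
  have hk' : (Matrix.toLin' A : Module.End ℝ (Fin n → ℝ)) ^ k = Matrix.toLin' (A ^ k) :=
    (Matrix.toLin'_pow A k).symm
  rw [hk', Submodule.disjoint_def] at hk
  refine Matrix.ext_of_mulVec_single fun j => ?_
  rw [Matrix.zero_mulVec]
  refine hk _ ?_ ⟨(Δ * (Aᵀ ^ k * X)) *ᵥ Pi.single j 1, ?_⟩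
  · rw [LinearMap.mem_ker, Matrix.toLin'_apply, Matrix.mulVec_mulVec]
    obtain ⟨k, rfl⟩ := Nat.exists_eq_add_of_le' hk1
    rw [pow_succ, Matrix.mul_assoc, hX, Matrix.mul_zero, Matrix.zero_mulVec]
  · rw [Matrix.toLin'_apply, Matrix.mulVec_mulVec]
    conv_rhs => rw [← hpow k]
    simp only [Matrix.mul_assoc]

theorem SolvesP.eq_of_isObservable {P P' : Matrix (Fin n) (Fin n) ℝ} (hP : SolvesP A B C D P)
    (hP' : SolvesP A B C D P') (ho : IsObservable A C) : P = P' := by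
  have h1 : A * (P - P') * Aᵀ = P - P' := by
    have := hP.1.trans hP'.1.symm
    rw [Matrix.mul_sub, Matrix.sub_mul]
    exact sub_eq_sub_iff_sub_eq_sub.1 this
  have h2 : A * ((P - P') * Cᵀ) = 0 := by
    have e1 := sub_eq_zero.1 hP.2.1
    have e2 := sub_eq_zero.1 hP'.2.1
    rw [Matrix.sub_mul, Matrix.mul_sub, ← Matrix.mul_assoc, ← Matrix.mul_assoc, ← e1, ← e2,
      sub_self]
  have h3 : ∀ k : ℕ, (P - P') * (Aᵀ ^ k * Cᵀ) = 0 := by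
    intro k
    induction k with
    | zero =>
      rw [pow_zero, Matrix.one_mul]
      exact mul_eq_zero_of_mul_mul_transpose_eq h1 h2
    | succ k ih =>
      refine mul_eq_zero_of_mul_mul_transpose_eq h1 ?_
      have h4 : A * ((P - P') * (Aᵀ ^ (k + 1) * Cᵀ))
          = A * (P - P') * Aᵀ * (Aᵀ ^ k * Cᵀ) := by
        rw [pow_succ']
        simp only [Matrix.mul_assoc]
      rw [h4, h1, ih]
  exact sub_eq_zero.1
    ((isObservable_iff_isReachable_transpose.1 ho).eq_zero_of_forall_mul_eq_zero h3)

/-- With `R = (xI - A)⁻¹` and `S = (x⁻¹I - A')⁻¹`, the term `R (A P A' - P) S` is a sum of terms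
with only one resolvent each. -/
theorem resolvent_mul_mul_resolvent {K : Type*} [Field K] {R S A A' : Matrix (Fin n) (Fin n) K}
    {x w : K} (hxw : x * w = 1) (hR : x • R = 1 + R * A) (hS : w • S = 1 + A' * S)
    (P : Matrix (Fin n) (Fin n) K) :
    R * (A * P * A' - P) * S = -P - R * A * P - P * (A' * S) := by
  have hR' : R * A = x • R - 1 := by rw [hR, add_sub_cancel_left]
  have hS' : A' * S = w • S - 1 := by rw [hS, add_sub_cancel_left]
  have h1 : R * (A * P * A' - P) * S = (R * A) * P * (A' * S) - R * P * S := by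
    simp only [mul_sub, sub_mul, mul_assoc]
  rw [h1, hR', hS']
  simp only [sub_mul, mul_sub, smul_mul_assoc, mul_smul_comm, smul_sub, smul_smul, mul_comm w x, hxw,
    one_smul, one_mul, mul_one]
  abel

theorem SolvesP.isAllPass {P : Matrix (Fin n) (Fin n) ℝ} (hP : P.IsSymm)
    (h : SolvesP A B C D P) : IsAllPass (transferFunction A B C D) := by
  obtain ⟨h1, h2, h3⟩ := h
  have h2' := sub_eq_zero.1 h2
  have h2t : D * Bᵀ = C * P * Aᵀ := by
    have := congrArg Matrix.transpose h2'
    simpa only [Matrix.transpose_mul, Matrix.transpose_transpose, hP.eq, Matrix.mul_assoc]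
      using this
  set R := resolvent A with hR
  set S := ((resolvent A).map invSubst)ᵀ with hS
  have hS' : (RatFunc.X : RatFunc ℝ)⁻¹ • S = 1 + const Aᵀ * S := by
    have e : ((RatFunc.X : RatFunc ℝ) • resolvent A).map invSubst = _ :=
      congrArg (fun M => M.map invSubst) (X_smul_resolvent' A)
    rw [map_invSubst_X_smul, Matrix.map_add _ (map_add _), Matrix.map_mul, map_invSubst_const,
      Matrix.map_one _ (map_zero _) (map_one _)] at e
    have e2 := congrArg Matrix.transpose e
    rwa [Matrix.transpose_smul, Matrix.transpose_add, Matrix.transpose_one,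
      Matrix.transpose_mul, ← const_transpose] at e2
  have key := resolvent_mul_mul_resolvent (mul_inv_cancel₀ RatFunc.X_ne_zero)
    (X_smul_resolvent' A) hS' (const P)
  rw [← const_mul, ← const_mul, ← const_sub, h1] at key
  have hpara : paraConj (transferFunction A B C D)
      = const Bᵀ * (S * const Cᵀ) + const Dᵀ := by
    rw [paraConj, map_invSubst_transferFunction, Matrix.transpose_add, Matrix.transpose_mul,
      Matrix.transpose_mul]
    rfl
  have e1 : const C * R * const B * (const Bᵀ * (S * const Cᵀ))
      = const C * (R * const (B * Bᵀ) * S) * const Cᵀ := by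
    rw [const_mul]
    simp only [Matrix.mul_assoc]
  have e2 : const C * R * const B * const Dᵀ = const C * (R * const A * const P) * const Cᵀ := by
    rw [Matrix.mul_assoc, ← const_mul B, h2', const_mul, const_mul]
    simp only [Matrix.mul_assoc]
  have e3 : const D * (const Bᵀ * (S * const Cᵀ))
      = const C * (const P * (const Aᵀ * S)) * const Cᵀ := by
    rw [← Matrix.mul_assoc, ← const_mul D, h2t, const_mul, const_mul]
    simp only [Matrix.mul_assoc]
  have e4 : const D * const Dᵀ = 1 + const C * const P * const Cᵀ := by
    rw [← const_mul, sub_eq_iff_eq_add.1 h3, const_add, const_one, const_mul, const_mul]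
  rw [IsAllPass, hpara, transferFunction_eq, Matrix.add_mul, Matrix.mul_add, Matrix.mul_add, ← hR,
    e1, e2, e3, e4, key]
  simp only [Matrix.mul_sub, Matrix.sub_mul, Matrix.mul_neg, Matrix.neg_mul]
  abel

theorem SolvesQ.isAllPass {Q : Matrix (Fin n) (Fin n) ℝ} (hQ : Q.IsSymm)
    (h : SolvesQ A B C D Q) : IsAllPass (transferFunction A B C D) := by
  have h1 := ((solvesQ_iff_solvesP_transpose.1 h).isAllPass hQ).transpose
  rwa [transferFunction_transpose, Matrix.transpose_transpose] at h1

/-- For `M = [A B; C D]` and `J = diag(P, -I)`, the equations (P) say `M J Mᵀ = J`, and then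
`Mᵀ J⁻¹ M = J⁻¹`, which are the equations (Q) for `P⁻¹`. -/
theorem SolvesP.solvesQ_inv {P : Matrix (Fin n) (Fin n) ℝ} (hP : P.IsSymm) (hPu : IsUnit P)
    (h : SolvesP A B C D P) : SolvesQ A B C D P⁻¹ := by
  obtain ⟨h1, h2, h3⟩ := h
  have hdet : IsUnit P.det := (Matrix.isUnit_iff_isUnit_det P).1 hPu
  have h2' := sub_eq_zero.1 h2
  have h2t : D * Bᵀ = C * P * Aᵀ := by
    have := congrArg Matrix.transpose h2'
    simpa only [Matrix.transpose_mul, Matrix.transpose_transpose, hP.eq, Matrix.mul_assoc]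
      using this
  set M := Matrix.fromBlocks A B C D with hM
  set J := Matrix.fromBlocks P 0 0 (-1 : Matrix (Fin m) (Fin m) ℝ) with hJ
  set J' := Matrix.fromBlocks P⁻¹ 0 0 (-1 : Matrix (Fin m) (Fin m) ℝ) with hJ'
  have hJJ' : J * J' = 1 := by
    rw [hJ, hJ', Matrix.fromBlocks_multiply, Matrix.mul_nonsing_inv _ hdet]
    simp
  have hMJ : M * J * Mᵀ = J := by
    rw [hM, hJ, Matrix.fromBlocks_transpose, Matrix.fromBlocks_multiply,
      Matrix.fromBlocks_multiply]
    congr 1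
    · simp only [Matrix.mul_zero, Matrix.mul_neg, Matrix.mul_one, add_zero, zero_add,
        Matrix.neg_mul, ← h1]
      abel
    · simp only [Matrix.mul_zero, Matrix.mul_neg, Matrix.mul_one, add_zero, zero_add,
        Matrix.neg_mul, h2']
      abel
    · simp only [Matrix.mul_zero, Matrix.mul_neg, Matrix.mul_one, add_zero, zero_add,
        Matrix.neg_mul, h2t]
      abel
    · simp only [Matrix.mul_zero, Matrix.mul_neg, Matrix.mul_one, add_zero, zero_add,
        Matrix.neg_mul, sub_eq_iff_eq_add.1 h3]
      abel
  have hinv : M * (J * Mᵀ * J') = 1 := by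
    rw [← Matrix.mul_assoc, ← Matrix.mul_assoc, hMJ, hJJ']
  have hinv' : J * (Mᵀ * J' * M) = 1 := by
    have := mul_eq_one_comm.1 hinv
    simpa only [Matrix.mul_assoc] using this
  have hdual : Mᵀ * J' * M = J' := by
    have h5 : J' * J = 1 := mul_eq_one_comm.1 hJJ'
    calc Mᵀ * J' * M = J' * (J * (Mᵀ * J' * M)) := by
          rw [← Matrix.mul_assoc J', h5, Matrix.one_mul]
      _ = J' := by rw [hinv', Matrix.mul_one]
  rw [hM, hJ', Matrix.fromBlocks_transpose, Matrix.fromBlocks_multiply,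
    Matrix.fromBlocks_multiply, Matrix.fromBlocks_inj] at hdual
  simp only [Matrix.mul_zero, Matrix.mul_neg, Matrix.mul_one, add_zero, zero_add,
    Matrix.neg_mul] at hdual
  obtain ⟨e1, e2, -, e4⟩ := hdual
  refine ⟨?_, ?_, ?_⟩
  · rw [← sub_eq_zero, ← sub_eq_zero.2 e1]
    abel
  · rw [← neg_eq_zero, ← e2]
    abel
  · rw [← neg_inj, ← e4]
    abel

theorem solvesP_iff_solvesQ_inv {P : Matrix (Fin n) (Fin n) ℝ} (hP : P.IsSymm) (hPu : IsUnit P) :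
    SolvesP A B C D P ↔ SolvesQ A B C D P⁻¹ := by
  refine ⟨fun h => h.solvesQ_inv hP hPu, fun h => ?_⟩
  have hdet : IsUnit P.det := (Matrix.isUnit_iff_isUnit_det P).1 hPu
  have h1 := (solvesQ_iff_solvesP_transpose.1 h).solvesQ_inv hP.inv
    (Matrix.isUnit_nonsing_inv_iff.2 hPu)
  rw [Matrix.nonsing_inv_nonsing_inv _ hdet] at h1
  exact solvesP_iff_solvesQ_transpose.2 h1

/-- `A` maps the unobservable subspace `N` onto itself, so `Q N` is invariant under `Aᵀ` and
annihilated by `Bᵀ`. -/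
theorem SolvesQ.isObservable {Q : Matrix (Fin n) (Fin n) ℝ} (hQ : Q.IsSymm) (hQu : IsUnit Q)
    (h : SolvesQ A B C D Q) (hr : IsReachable A B) : IsObservable A C := by
  obtain ⟨h1, h2, -⟩ := h
  have hQinj := Matrix.mulVec_injective_iff_isUnit.2 hQu
  have h2t : Dᵀ * C = Bᵀ * Q * A := by
    have := congrArg Matrix.transpose (sub_eq_zero.1 h2)
    simpa only [Matrix.transpose_mul, Matrix.transpose_transpose, hQ.eq, Matrix.mul_assoc]
      using this
  let N : Submodule ℝ (Fin n → ℝ) := ⨅ k : ℕ, LinearMap.ker (C * A ^ k).mulVecLin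
  have hN : ∀ x, x ∈ N ↔ ∀ k : ℕ, (C * A ^ k) *ᵥ x = 0 := by
    intro x
    simp [N, Submodule.mem_iInf]
  have hC : ∀ x ∈ N, C *ᵥ x = 0 := fun x hx => by simpa using (hN x).1 hx 0
  have hAN : ∀ x ∈ N, A.mulVecLin x ∈ N := by
    intro x hx
    rw [hN]
    intro k
    rw [Matrix.mulVecLin_apply, Matrix.mulVec_mulVec, Matrix.mul_assoc, ← pow_succ]
    exact (hN x).1 hx (k + 1)
  have hQA : ∀ x ∈ N, Aᵀ *ᵥ Q *ᵥ A *ᵥ x = Q *ᵥ x := by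
    intro x hx
    have e := congrArg (fun M => M *ᵥ x) h1
    simp only [Matrix.sub_mulVec, ← Matrix.mulVec_mulVec, hC x hx, Matrix.mulVec_zero] at e
    exact sub_eq_zero.1 e
  have hsurj : ∀ x ∈ N, ∃ y ∈ N, A *ᵥ y = x := by
    have hinj : Function.Injective (A.mulVecLin.restrict hAN) := by
      rw [← LinearMap.ker_eq_bot, LinearMap.ker_eq_bot']
      rintro ⟨x, hx⟩ hx0
      have hx0 : A *ᵥ x = 0 := congrArg Subtype.val hx0
      have e := hQA x hx
      rw [hx0, Matrix.mulVec_zero, Matrix.mulVec_zero] at e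
      exact Subtype.ext (hQinj (e.symm.trans (Matrix.mulVec_zero Q).symm))
    intro x hx
    obtain ⟨y, hy⟩ := LinearMap.injective_iff_surjective.1 hinj ⟨x, hx⟩
    exact ⟨y, y.2, congrArg Subtype.val hy⟩
  have hB : ∀ k : ℕ, ∀ x ∈ N, (Bᵀ * Aᵀ ^ k) *ᵥ Q *ᵥ x = 0 := by
    intro k
    induction k with
    | zero =>
      intro x hx
      obtain ⟨y, hy, rfl⟩ := hsurj x hx
      rw [pow_zero, Matrix.mul_one, Matrix.mulVec_mulVec, Matrix.mulVec_mulVec,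
        ← h2t, ← Matrix.mulVec_mulVec, hC y hy, Matrix.mulVec_zero]
    | succ k ih =>
      intro x hx
      obtain ⟨y, hy, rfl⟩ := hsurj x hx
      rw [pow_succ, ← Matrix.mul_assoc, ← Matrix.mulVec_mulVec, hQA y hy]
      exact ih y hy
  refine isObservable_iff_isReachable_transpose.2 (isReachable_iff.2 fun x hx => ?_)
  have hxN : x ∈ N := by
    rw [hN]
    intro k
    rw [← hx k, ← Matrix.mulVec_transpose, Matrix.transpose_mul, Matrix.transpose_pow,
      Matrix.transpose_transpose, Matrix.transpose_transpose]
  refine hQinj (Eq.trans ?_ (Matrix.mulVec_zero Q).symm)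
  refine isReachable_iff.1 hr _ fun k => ?_
  rw [← Matrix.mulVec_transpose, Matrix.transpose_mul, Matrix.transpose_pow]
  exact hB k x hxN

/-- Two matrices with the same Gram matrix differ by an orthogonal factor on the left. -/
theorem exists_orthogonal_mul_eq {C C₀ : Matrix (Fin m) (Fin n) ℝ} (h : Cᵀ * C = C₀ᵀ * C₀) :
    ∃ O : Matrix (Fin m) (Fin m) ℝ, O * Oᵀ = 1 ∧ C = O * C₀ := by
  let e : (Fin m → ℝ) ≃ₗ[ℝ] EuclideanSpace ℝ (Fin m) := (WithLp.linearEquiv 2 ℝ (Fin m → ℝ)).symm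
  let f : (Fin n → ℝ) →ₗ[ℝ] EuclideanSpace ℝ (Fin m) := e.toLinearMap ∘ₗ C.mulVecLin
  let f₀ : (Fin n → ℝ) →ₗ[ℝ] EuclideanSpace ℝ (Fin m) := e.toLinearMap ∘ₗ C₀.mulVecLin
  have hdot : ∀ (M : Matrix (Fin m) (Fin n) ℝ) (x : Fin n → ℝ),
      ‖e (M *ᵥ x)‖ ^ 2 = x ⬝ᵥ (Mᵀ * M) *ᵥ x := by
    intro M x
    rw [EuclideanSpace.real_norm_sq_eq, ← Matrix.mulVec_mulVec, Matrix.dotProduct_mulVec,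
      Matrix.vecMul_transpose]
    exact Finset.sum_congr rfl fun i _ => sq _
  have hnorm : ∀ x, ‖f x‖ = ‖f₀ x‖ := by
    intro x
    have h1 : ‖f x‖ ^ 2 = ‖f₀ x‖ ^ 2 := ((hdot C x).trans (by rw [h])).trans (hdot C₀ x).symm
    exact (sq_eq_sq₀ (norm_nonneg _) (norm_nonneg _)).1 h1
  obtain ⟨g, hg⟩ := f₀.rangeRestrict.exists_rightInverse_of_surjective f₀.range_rangeRestrict
  have hg' : ∀ s, f₀ (g s) = s := fun s => congrArg Subtype.val (LinearMap.congr_fun hg s)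
  let L : LinearMap.range f₀ →ₗᵢ[ℝ] EuclideanSpace ℝ (Fin m) :=
    ⟨f ∘ₗ g, fun s => by rw [LinearMap.comp_apply, hnorm, hg', Submodule.coe_norm]⟩
  have hL : ∀ x, L.extend (f₀ x) = f x := by
    intro x
    have h1 : L.extend (f₀ x) = L ⟨f₀ x, x, rfl⟩ := L.extend_apply ⟨f₀ x, x, rfl⟩
    have h2 : L ⟨f₀ x, x, rfl⟩ = f (g ⟨f₀ x, x, rfl⟩) := rfl
    rw [h1, h2, ← sub_eq_zero, ← map_sub, ← norm_eq_zero, hnorm, map_sub, hg', sub_self, norm_zero]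
  let b := EuclideanSpace.basisFun (Fin m) ℝ
  let O : Matrix (Fin m) (Fin m) ℝ := Matrix.of fun i j => L.extend (b j) i
  have hO : ∀ y : Fin m → ℝ, e (O *ᵥ y) = L.extend (e y) := by
    intro y
    have h1 : e y = ∑ j, y j • b j := by
      conv_lhs => rw [← b.sum_repr (e y)]
      rfl
    rw [h1, map_sum]
    ext i
    simp only [map_smul]
    simp [e, O, Matrix.mulVec, dotProduct, mul_comm]
  refine ⟨O, mul_eq_one_comm.1 ?_, ?_⟩
  · ext j k
    have h1 : (Oᵀ * O) j k = inner ℝ (L.extend (b j)) (L.extend (b k)) := by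
      rw [PiLp.inner_apply, Matrix.mul_apply]
      exact Finset.sum_congr rfl fun i _ => mul_comm _ _
    rw [h1, LinearIsometry.inner_map_map, OrthonormalBasis.inner_eq_ite, Matrix.one_apply]
  · refine Matrix.ext_of_mulVec_single fun j => ?_
    refine e.injective ?_
    rw [← Matrix.mulVec_mulVec, hO]
    exact (hL _).symm

end Equations

/-! ### Realizations of all-pass functions -/

section Realization

variable {n m : ℕ} {A : Matrix (Fin n) (Fin n) ℝ} {B : Matrix (Fin n) (Fin m) ℝ}
  {C : Matrix (Fin m) (Fin n) ℝ} {D : Matrix (Fin m) (Fin m) ℝ}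

theorem IsMinimalAllPass.exists_solvesP (h : IsMinimalAllPass A B C D) :
    ∃ P : Matrix (Fin n) (Fin n) ℝ, P.IsSymm ∧ IsUnit P ∧ SolvesP A B C D P := by
  obtain ⟨P, hP, hs⟩ := exists_isSymm_solvesP h.2 h.1.isObservable
  exact ⟨P, hP, isUnit_of_isReachable h.1.isReachable hP hs.1, hs⟩

theorem IsMinimalAllPass.isUnit_iff (h : IsMinimalAllPass A B C D) : IsUnit A ↔ IsUnit D := by
  obtain ⟨P, hP, hPu, hs⟩ := h.exists_solvesP
  constructor
  · intro hA
    obtain ⟨-, h2, h3⟩ := hs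
    rw [← Matrix.isUnit_transpose, ← Matrix.mulVec_injective_iff_isUnit, ← Matrix.coe_mulVecLin,
      ← LinearMap.ker_eq_bot, LinearMap.ker_eq_bot']
    intro y hy
    have hy : Dᵀ *ᵥ y = 0 := hy
    have h4 : A *ᵥ P *ᵥ Cᵀ *ᵥ y = 0 := by
      rw [Matrix.mulVec_mulVec, Matrix.mulVec_mulVec, ← sub_eq_zero.1 h2, ← Matrix.mulVec_mulVec,
        hy, Matrix.mulVec_zero]
    have h5 : P *ᵥ Cᵀ *ᵥ y = 0 :=
      Matrix.mulVec_injective_iff_isUnit.2 hA (h4.trans (Matrix.mulVec_zero A).symm)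
    have h6 := congrArg (fun M => M *ᵥ y) h3
    simp only [Matrix.sub_mulVec, ← Matrix.mulVec_mulVec, hy, h5, Matrix.mulVec_zero, sub_zero,
      Matrix.one_mulVec] at h6
    exact h6.symm
  · intro hD
    obtain ⟨h1, h2, -⟩ := hs.solvesQ_inv hP hPu
    have h2t : Dᵀ * C = Bᵀ * P⁻¹ * A := by
      have := congrArg Matrix.transpose (sub_eq_zero.1 h2)
      simpa only [Matrix.transpose_mul, Matrix.transpose_transpose, hP.inv.eq, Matrix.mul_assoc]
        using this
    rw [← Matrix.mulVec_injective_iff_isUnit, ← Matrix.coe_mulVecLin,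
      ← LinearMap.ker_eq_bot, LinearMap.ker_eq_bot']
    intro x hx
    have hx : A *ᵥ x = 0 := hx
    have h4 : Dᵀ *ᵥ C *ᵥ x = 0 := by
      rw [Matrix.mulVec_mulVec, h2t, ← Matrix.mulVec_mulVec, hx, Matrix.mulVec_zero]
    have h5 : C *ᵥ x = 0 := Matrix.mulVec_injective_iff_isUnit.2
      ((Matrix.isUnit_transpose D).2 hD) (h4.trans (Matrix.mulVec_zero _).symm)
    have h6 := congrArg (fun M => M *ᵥ x) h1
    simp only [Matrix.sub_mulVec, ← Matrix.mulVec_mulVec, hx, h5, Matrix.mulVec_zero, zero_sub,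
      neg_eq_zero] at h6
    exact Matrix.mulVec_injective_iff_isUnit.2 (Matrix.isUnit_nonsing_inv_iff.2 hPu)
      (h6.trans (Matrix.mulVec_zero _).symm)

theorem SolvesP.isMinimalAllPass {P : Matrix (Fin n) (Fin n) ℝ} (hr : IsReachable A B)
    (hP : P.IsSymm) (h : SolvesP A B C D P) : IsMinimalAllPass A B C D := by
  have hPu := isUnit_of_isReachable hr hP h.1
  exact ⟨isMinimal_of_isReachable_of_isObservable D hr
    ((h.solvesQ_inv hP hPu).isObservable hP.inv (Matrix.isUnit_nonsing_inv_iff.2 hPu) hr),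
    h.isAllPass hP⟩

theorem steinEquation_iff_of_isReachable (hr : IsReachable A B) {P : Matrix (Fin n) (Fin n) ℝ}
    (hP : P.IsSymm) :
    A * P * Aᵀ - P = B * Bᵀ ↔
      ∃ (C : Matrix (Fin m) (Fin n) ℝ) (D : Matrix (Fin m) (Fin m) ℝ),
        IsMinimalAllPass A B C D ∧ SolvesP A B C D P := by
  constructor
  · intro h
    obtain ⟨C, D, hs⟩ := AllPass.exists_solvesP hP (isUnit_of_isReachable hr hP h) h
    exact ⟨C, D, hs.isMinimalAllPass hr hP, hs⟩
  · rintro ⟨C, D, -, hs⟩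
    exact hs.1

/-- If `D` completes `P` to a solution of (P), then `I + Bᵀ P⁻¹ B = Dᵀ D`. -/
theorem posSemidef_one_add_of_isReachable (hr : IsReachable A B) {P : Matrix (Fin n) (Fin n) ℝ}
    (hP : P.IsSymm) (h : A * P * Aᵀ - P = B * Bᵀ) : (1 + Bᵀ * P⁻¹ * B).PosSemidef := by
  have hPu := isUnit_of_isReachable hr hP h
  obtain ⟨C, D, hs⟩ := AllPass.exists_solvesP hP hPu h
  obtain ⟨-, -, h3⟩ := hs.solvesQ_inv hP hPu
  rw [← sub_eq_iff_eq_add.1 h3, ← Matrix.conjTranspose_eq_transpose_of_trivial D]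
  exact Matrix.posSemidef_conjTranspose_mul_self D

/-- The equation for `P` alone can be completed to a solution `(C₀, D₀)` of (P); since
`Cᵀ C = C₀ᵀ C₀`, an orthogonal factor turns `C₀` into `C`. -/
theorem exists_isAllPass_of_mul_eq_one {P Q : Matrix (Fin n) (Fin n) ℝ} (hP : P.IsSymm)
    (h1 : A * P * Aᵀ - P = B * Bᵀ) (h2 : Aᵀ * Q * A - Q = Cᵀ * C) (hPQ : P * Q = 1) :
    ∃ D : Matrix (Fin m) (Fin m) ℝ, IsAllPass (transferFunction A B C D) := by
  have hPu : IsUnit P := (Matrix.isUnit_iff_isUnit_det P).2 (Matrix.isUnit_det_of_right_inverse hPQ)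
  obtain ⟨C₀, D₀, hs⟩ := AllPass.exists_solvesP hP hPu h1
  have hQ : P⁻¹ = Q := Matrix.inv_eq_right_inv hPQ
  have hs' := hs.solvesQ_inv hP hPu
  rw [hQ] at hs'
  obtain ⟨O, hO, rfl⟩ := exists_orthogonal_mul_eq (h2.symm.trans hs'.1)
  refine ⟨O * D₀, SolvesP.isAllPass hP ⟨h1, ?_, ?_⟩⟩
  · rw [Matrix.transpose_mul, Matrix.transpose_mul, ← Matrix.mul_assoc, ← Matrix.mul_assoc,
      ← Matrix.sub_mul, hs.2.1, Matrix.zero_mul]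
  · have h3 : O * D₀ * (O * D₀)ᵀ - O * C₀ * P * (O * C₀)ᵀ
        = O * (D₀ * D₀ᵀ - C₀ * P * C₀ᵀ) * Oᵀ := by
      simp only [Matrix.transpose_mul, Matrix.mul_sub, Matrix.sub_mul, Matrix.mul_assoc]
    rw [h3, hs.2.2, Matrix.mul_one, hO]

end Realization

end AllPass

end

theorem mainTheorem1 (n m : ℕ) :
    -- 1. invertibility of `A` and `D`
    (∀ (A : Matrix (Fin n) (Fin n) ℝ) (B : Matrix (Fin n) (Fin m) ℝ)
        (C : Matrix (Fin m) (Fin n) ℝ) (D : Matrix (Fin m) (Fin m) ℝ),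
      AllPass.IsMinimalAllPass A B C D → (IsUnit A ↔ IsUnit D)) ∧
    -- 2. existence of `P` and `Q`
    (∀ (A : Matrix (Fin n) (Fin n) ℝ) (B : Matrix (Fin n) (Fin m) ℝ)
        (C : Matrix (Fin m) (Fin n) ℝ) (D : Matrix (Fin m) (Fin m) ℝ),
      AllPass.IsMinimalAllPass A B C D →
      ∃ P Q : Matrix (Fin n) (Fin n) ℝ, P.IsSymm ∧ Q.IsSymm ∧ IsUnit P ∧ IsUnit Q ∧ P * Q = 1 ∧
        AllPass.SolvesP A B C D P ∧ AllPass.SolvesQ A B C D Q) ∧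
    -- 3. uniqueness, among all matrices
    (∀ (A : Matrix (Fin n) (Fin n) ℝ) (B : Matrix (Fin n) (Fin m) ℝ)
        (C : Matrix (Fin m) (Fin n) ℝ) (D : Matrix (Fin m) (Fin m) ℝ),
      AllPass.IsMinimalAllPass A B C D →
      (∀ P P' : Matrix (Fin n) (Fin n) ℝ,
        AllPass.SolvesP A B C D P → AllPass.SolvesP A B C D P' → P = P') ∧
      (∀ Q Q' : Matrix (Fin n) (Fin n) ℝ,
        AllPass.SolvesQ A B C D Q → AllPass.SolvesQ A B C D Q' → Q = Q')) ∧
    -- 4. the converse, without minimality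
    (∀ (A : Matrix (Fin n) (Fin n) ℝ) (B : Matrix (Fin n) (Fin m) ℝ)
        (C : Matrix (Fin m) (Fin n) ℝ) (D : Matrix (Fin m) (Fin m) ℝ),
      ((∃ P : Matrix (Fin n) (Fin n) ℝ, P.IsSymm ∧ AllPass.SolvesP A B C D P) →
        AllPass.IsAllPass (AllPass.transferFunction A B C D)) ∧
      ((∃ Q : Matrix (Fin n) (Fin n) ℝ, Q.IsSymm ∧ AllPass.SolvesQ A B C D Q) →
        AllPass.IsAllPass (AllPass.transferFunction A B C D)) ∧
      (∀ P : Matrix (Fin n) (Fin n) ℝ, P.IsSymm → IsUnit P →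
        (AllPass.SolvesP A B C D P ↔ AllPass.SolvesQ A B C D P⁻¹))) ∧
    -- 5. reachable pairs
    (∀ (A : Matrix (Fin n) (Fin n) ℝ) (B : Matrix (Fin n) (Fin m) ℝ),
      AllPass.IsReachable A B →
      ∀ P : Matrix (Fin n) (Fin n) ℝ, P.IsSymm →
        (A * P * Aᵀ - P = B * Bᵀ ↔
          ∃ (C : Matrix (Fin m) (Fin n) ℝ) (D : Matrix (Fin m) (Fin m) ℝ),
            AllPass.IsMinimalAllPass A B C D ∧ AllPass.SolvesP A B C D P) ∧
        (A * P * Aᵀ - P = B * Bᵀ → IsUnit P ∧ (1 + Bᵀ * P⁻¹ * B).PosSemidef)) ∧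
    -- 6. observable pairs
    (∀ (A : Matrix (Fin n) (Fin n) ℝ) (C : Matrix (Fin m) (Fin n) ℝ),
      AllPass.IsObservable A C →
      ∀ Q : Matrix (Fin n) (Fin n) ℝ, Q.IsSymm →
        (Aᵀ * Q * A - Q = Cᵀ * C ↔
          ∃ (B : Matrix (Fin n) (Fin m) ℝ) (D : Matrix (Fin m) (Fin m) ℝ),
            AllPass.IsMinimalAllPass A B C D ∧ AllPass.SolvesQ A B C D Q) ∧
        (Aᵀ * Q * A - Q = Cᵀ * C → IsUnit Q ∧ (1 + C * Q⁻¹ * Cᵀ).PosSemidef)) ∧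
    -- 7. joint equations
    (∀ (A : Matrix (Fin n) (Fin n) ℝ) (B : Matrix (Fin n) (Fin m) ℝ)
        (C : Matrix (Fin m) (Fin n) ℝ),
      (∃ P Q : Matrix (Fin n) (Fin n) ℝ, P.IsSymm ∧ Q.IsSymm ∧
        A * P * Aᵀ - P = B * Bᵀ ∧ Aᵀ * Q * A - Q = Cᵀ * C ∧ P * Q = 1) →
      ∃ D : Matrix (Fin m) (Fin m) ℝ,
        AllPass.IsAllPass (AllPass.transferFunction A B C D)) := by
  refine ⟨fun A B C D h => h.isUnit_iff, ?_, ?_, ?_, ?_, ?_, ?_⟩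
  · intro A B C D h
    obtain ⟨P, hP, hPu, hs⟩ := h.exists_solvesP
    exact ⟨P, P⁻¹, hP, hP.inv, hPu, Matrix.isUnit_nonsing_inv_iff.2 hPu,
      Matrix.mul_nonsing_inv _ ((Matrix.isUnit_iff_isUnit_det P).1 hPu), hs, hs.solvesQ_inv hP hPu⟩
  · intro A B C D h
    refine ⟨fun P P' hP hP' => hP.eq_of_isObservable hP' h.1.isObservable, fun Q Q' hQ hQ' => ?_⟩
    exact (AllPass.solvesQ_iff_solvesP_transpose.1 hQ).eq_of_isObservable
      (AllPass.solvesQ_iff_solvesP_transpose.1 hQ') h.transpose.1.isObservable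
  · intro A B C D
    exact ⟨fun ⟨P, hP, hs⟩ => hs.isAllPass hP, fun ⟨Q, hQ, hs⟩ => hs.isAllPass hQ,
      fun P hP hPu => AllPass.solvesP_iff_solvesQ_inv hP hPu⟩
  · intro A B hr P hP
    exact ⟨AllPass.steinEquation_iff_of_isReachable hr hP, fun h =>
      ⟨AllPass.isUnit_of_isReachable hr hP h, AllPass.posSemidef_one_add_of_isReachable hr hP h⟩⟩
  · intro A C ho Q hQ
    have hr := AllPass.isObservable_iff_isReachable_transpose.1 ho
    have hiff := AllPass.steinEquation_iff_of_isReachable hr hQ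
    have hunit := AllPass.isUnit_of_isReachable hr hQ
    have hpos := AllPass.posSemidef_one_add_of_isReachable hr hQ
    simp only [Matrix.transpose_transpose] at hiff hunit hpos
    refine ⟨hiff.trans ⟨?_, ?_⟩, fun h => ⟨hunit h, hpos h⟩⟩
    · rintro ⟨B, D, hmin, hs⟩
      exact ⟨Bᵀ, Dᵀ, by simpa only [Matrix.transpose_transpose] using hmin.transpose,
        AllPass.solvesQ_iff_solvesP_transpose.2 (by simpa only [Matrix.transpose_transpose] using hs)⟩
    · rintro ⟨B, D, hmin, hs⟩
      exact ⟨Bᵀ, Dᵀ, hmin.transpose, AllPass.solvesQ_iff_solvesP_transpose.1 hs⟩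
  · rintro A B C ⟨P, Q, hP, -, h1, h2, hPQ⟩
    exact AllPass.exists_isAllPass_of_mul_eq_one hP h1 h2 hPQ
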